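/- Let $\mathcal R$ be the Levi-Civita field: the functions $x:\mathbb Q\to\mathbb R$ whose support has finitely many elements below each rational, with pointwise sum, Cauchy product, and $x<y$ iff $x(q)<y(q)$ at the least $q$ where $x$ and $y$ differ; $\mathbb R\subset\mathcal R$. Call $x\in\mathcal R$ finite if $|x|<r$ for some $r\in\mathbb R$, and let its standard part be $\operatorname{sh}(x)=\inf\{r\in\mathbb R: x\le r\}\in[-\infty,+\infty]$. Limits and sums of series of numbers are taken in the order topology of $\mathcal R$, unless called weak. A sequence $c_m$ converges weakly to $l$ if for every real $\varepsilon>0$ one has $|(c_m-l)(q)|<\varepsilon$ for all $q\le\varepsilon^{-1}$ and all large $m$. An interval $I(a,b)$ is a bounded interval of $\mathcal R$ with endpoints $a\le b$, each of which may or may not belong to it, and $l(I(a,b))=b-a$. *Measure.* A set $A\subseteq\mathcal R$ is measurable if for every $\varepsilon>0$ in $\mathcal R$ there are sequences of mutually disjoint intervals $(I_n)$, $(J_n)$ with $\bigcup_n I_n\subseteq A\subseteq\bigcup_n J_n$, with $\sum_n l(I_n)$ and $\sum_n l(J_n)$ convergent, and $\sum_n l(J_n)-\sum_n l(I_n)\le\varepsilon$.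 Its measure $m(A)\in\mathcal R$ is the supremum of the sums $\sum_n l(I_n)$, equivalently the infimum of the sums $\sum_n l(J_n)$, over such inner, respectively outer, sequences. *Measurable functions.* A function $f$ is simple on $I(a,b)$ if it is there the sum of a power series $\sum_n a_n(x-x_0)^n$, with $a_n\in\mathcal R$ and $x_0\in[a,b]$, that converges weakly at every point of $I(a,b)$. A function $f:A\to\mathcal R$ on a measurable set $A$ is measurable if for every $\varepsilon>0$ in $\mathcal R$ there is a sequence of mutually disjoint intervals $I_n$ with $\bigcup_n I_n\subseteq A$, $\sum_n l(I_n)$ convergent, $m(A)-\sum_n l(I_n)<\varepsilon$, and $f$ simple on every $I_n$. *Shamseddine–Berz integral.* If $f$ is simple on $I(a,b)$ and $F$ is a simple antiderivative of $f$, then $\int_{I(a,b)}f=\lim_{x\to b}F(x)-\lim_{x\to a}F(x)$. If $f$ is measurable on $A$, then $\int_A f\in\mathcal R$ is the limit of $\sum_n\int_{I_n}f$ as $\sum_n l(I_n)\to m(A)$, over all sequences of mutually disjoint intervals $I_n$ with $\bigcup_n I_n\subseteq A$ on each of which $f$ is simple, when this limit exists in $\mathcal R$. Let $\mathcal L^1(A)$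 be the set of measurable $f:A\to\mathcal R$ for which $\int_A|f|$ exists in $\mathcal R$. *$M$-integral.* For $f:A\to\mathcal R$ put $$L(f)=\sup\Big\{\operatorname{sh}\Big(\int_A g\Big): g\in\mathcal L^1(A),\ g\le f \text{ on } A\Big\},\qquad U(f)=\inf\Big\{\operatorname{sh}\Big(\int_A g\Big): g\in\mathcal L^1(A),\ g\ge f\text{ on } A\Big\}.$$ If $f$ is bounded, it is $M$-integrable iff $L(f)=U(f)$, and then $\int_A^M f=L(f)$. If $f$ is unbounded and non-negative, it is $M$-integrable iff $L(f)<+\infty$, and then $\int_A^M f=L(f)$. If $f$ is unbounded and non-positive, it is $M$-integrable iff $f^-$ is, and then $\int_A^M f=-\int_A^M f^-$. Any other unbounded $f$ is $M$-integrable iff $f^+$ and $f^-$ are, and then $\int_A^M f=\int_A^M f^+-\int_A^M f^-$. **Proposition.** Let $A\subset\mathcal R$ be measurable and let $f\in\mathcal L^1(A)$ be such that $\int_A|f|$ is a finite element of $\mathcal R$. Then $\int_A f$ exists in $\mathcal R$, $f$ is $M$-integrable over $A$, and $$\int_A^M f=\operatorname{sh}\Big(\int_A f\Big).$$ -/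

import Mathlib

open Filter Topology

namespace LC

/-! ### The Levi-Civita field -/

/-- A set of rationals is left-finite if it has finitely many elements below each rational. -/
def LeftFinite (F : Set ℚ) : Prop := ∀ q : ℚ, {x ∈ F | x ≤ q}.Finite

theorem LeftFinite.mono {F G : Set ℚ} (hG : LeftFinite G) (h : F ⊆ G) : LeftFinite F :=
  fun q => (hG q).subset fun _ hx => ⟨h hx.1, hx.2⟩

theorem LeftFinite.union {F G : Set ℚ} (hF : LeftFinite F) (hG : LeftFinite G) :
    LeftFinite (F ∪ G) := by
  intro q
  refine ((hF q).union (hG q)).subset ?_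
  rintro x ⟨hx | hx, hq⟩
  · exact Or.inl ⟨hx, hq⟩
  · exact Or.inr ⟨hx, hq⟩

theorem leftFinite_of_finite {F : Set ℚ} (h : F.Finite) : LeftFinite F :=
  fun _ => h.subset fun _ hx => hx.1

theorem leftFinite_support_mul {x y : HahnSeries ℚ ℝ} (hx : LeftFinite x.support)
    (hy : LeftFinite y.support) : LeftFinite (x * y).support := by
  intro q
  by_cases hx0 : x = 0
  · subst hx0; simp
  by_cases hy0 : y = 0
  · subst hy0; simp
  refine ((hx (q - y.order)).add (hy (q - x.order))).subset ?_
  rintro g ⟨hg, hgq⟩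
  obtain ⟨u, hu, v, hv, rfl⟩ := Set.mem_add.1 (HahnSeries.support_mul_subset hg)
  have h1 : x.order ≤ u := HahnSeries.order_le_of_coeff_ne_zero hu
  have h2 : y.order ≤ v := HahnSeries.order_le_of_coeff_ne_zero hv
  exact Set.add_mem_add ⟨hu, by linarith⟩ ⟨hv, by linarith⟩

theorem leftFinite_support_inv {x : HahnSeries ℚ ℝ} (hx : LeftFinite x.support) :
    LeftFinite (x⁻¹).support := by
  by_cases hx0 : x = 0
  · subst hx0; simpa using hx
  set y := x⁻¹ with hy
  have hxy : x * y = 1 := mul_inv_cancel₀ hx0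
  have hy0 : y ≠ 0 := inv_ne_zero hx0
  have hord : x.order + y.order = 0 := by
    rw [← HahnSeries.order_mul hx0 hy0, hxy, HahnSeries.order_one]
  set o := x.order with ho
  -- the gap after the leading exponent
  obtain ⟨η, hη, hgap⟩ : ∃ η : ℚ, 0 < η ∧ ∀ e ∈ x.support, e ≠ o → o + η ≤ e := by
    have hfin : ({e ∈ x.support | e ≤ o + 1} \ {o}).Finite := (hx (o + 1)).subset Set.sdiff_subset
    rcases Set.eq_empty_or_nonempty ({e ∈ x.support | e ≤ o + 1} \ {o}) with h | h
    · refine ⟨1, one_pos, fun e he hne => ?_⟩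
      by_contra! hlt
      have : e ∈ ({e ∈ x.support | e ≤ o + 1} \ {o}) := ⟨⟨he, hlt.le⟩, hne⟩
      rw [h] at this
      exact this
    · obtain ⟨m, hm, hmin⟩ := Set.exists_min_image _ id hfin h
      have hom : o < m :=
        lt_of_le_of_ne (HahnSeries.order_le_of_coeff_ne_zero hm.1.1) (Ne.symm hm.2)
      refine ⟨m - o, by linarith, fun e he hne => ?_⟩
      by_cases hle : e ≤ o + 1
      · have := hmin e ⟨⟨he, hle⟩, hne⟩
        simp only [id] at this
        linarith
      · have := hm.1.2
        linarith
  -- recursive description of the support of the inverse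
  have hrec : ∀ g ∈ y.support, g = -o ∨
      ∃ e ∈ x.support, e ≠ o ∧ ∃ g' ∈ y.support, g = e - o + g' := by
    intro g hg
    by_contra! hcon
    obtain ⟨h1, h2⟩ := hcon
    have hc : (x * y).coeff (o + g) = x.coeff o * y.coeff g := by
      rw [HahnSeries.coeff_mul]
      refine Finset.sum_eq_single (o, g) ?_ ?_
      · rintro ⟨i, j⟩ hij hne
        rw [Finset.mem_antidiagonal] at hij
        obtain ⟨hi, hj, hs⟩ := hij
        simp only at hi hj hs
        by_cases hio : i = o
        · exact absurd (Prod.ext hio (by simp only; linarith)) hne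
        · exact absurd (by linarith) (h2 i hi hio j hj)
      · intro hn
        by_contra hne
        apply hn
        rw [Finset.mem_antidiagonal]
        exact ⟨left_ne_zero_of_mul hne, hg, rfl⟩
    rw [hxy, HahnSeries.coeff_one, if_neg (fun h => h1 (by linarith))] at hc
    have : x.coeff o ≠ 0 := by
      rw [ho]; exact HahnSeries.coeff_order_eq_zero.not.2 hx0
    exact (mul_ne_zero this hg) hc.symm
  have hfin : ∀ n : ℕ, {g ∈ y.support | g < -o + n * η}.Finite := by
    intro n
    induction n with
    | zero =>
      refine Set.finite_empty.subset ?_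
      rintro g ⟨hg, hlt⟩
      have := HahnSeries.order_le_of_coeff_ne_zero hg
      simp only [Nat.cast_zero, zero_mul, add_zero] at hlt
      linarith
    | succ n ih =>
      refine ((Set.finite_singleton (-o)).union
        (((hx (o + (n + 1) * η)).image (fun e => e - o)).add ih)).subset ?_
      rintro g ⟨hg, hlt⟩
      push_cast at hlt
      rcases hrec g hg with h | ⟨e, he, hne, g', hg', rfl⟩
      · exact Or.inl h
      · right
        have h1 := hgap e he hne
        have h2 : y.order ≤ g' := HahnSeries.order_le_of_coeff_ne_zero hg'
        exact Set.add_mem_add ⟨e, ⟨he, by linarith⟩, rfl⟩ ⟨hg', by linarith⟩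
  intro q
  obtain ⟨n, hn⟩ := exists_nat_gt ((q + o) / η)
  rw [div_lt_iff₀ hη] at hn
  refine (hfin n).subset ?_
  rintro g ⟨hg, hgq⟩
  exact ⟨hg, by linarith⟩

/-- The formal series `ℚ → ℝ` with left-finite support, as a subfield of the field of Hahn
series. Sum and order are those of the Levi-Civita field (pointwise sum, Cauchy product,
`x < y` iff the coefficients at the first exponent where they differ are so ordered). -/
noncomputable def leviCivitaSubfield : Subfield (Lex (HahnSeries ℚ ℝ)) where
  carrier := {x | LeftFinite (ofLex x).support}
  mul_mem' hx hy := leftFinite_support_mul hx hy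
  one_mem' := leftFinite_of_finite ((Set.finite_singleton (0 : ℚ)).subset
    (HahnSeries.support_single_subset (a := (0 : ℚ)) (r := (1 : ℝ))))
  add_mem' hx hy := (LeftFinite.union hx hy).mono (HahnSeries.support_add_subset _ _)
  zero_mem' := leftFinite_of_finite (by simp)
  neg_mem' {x} hx := by
    have : (ofLex (-x)).support = (ofLex x).support := HahnSeries.support_neg
    simpa [this] using hx
  inv_mem' _ hx := leftFinite_support_inv hx

/-- The Levi-Civita field. -/
abbrev LeviCivita : Type := leviCivitaSubfield

/-- The order topology of the Levi-Civita field; its convergence is strong convergence. -/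
instance : TopologicalSpace LeviCivita := Preorder.topology LeviCivita

instance : OrderTopology LeviCivita := ⟨rfl⟩

/-- The value `x(q)` of `x : ℚ → ℝ`. -/
def coeff (x : LeviCivita) (q : ℚ) : ℝ := (ofLex (x : Lex (HahnSeries ℚ ℝ))).coeff q

/-- The real number `r` as an element of the Levi-Civita field. -/
noncomputable def ofReal (r : ℝ) : LeviCivita :=
  ⟨toLex (HahnSeries.single (0 : ℚ) r), leftFinite_of_finite
    ((Set.finite_singleton (0 : ℚ)).subset HahnSeries.support_single_subset)⟩

/-- `x` is finite: bounded in absolute value by a real number. -/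
def IsFinite (x : LeviCivita) : Prop := ∃ r : ℝ, |x| < ofReal r

/-- The standard part, `inf {r ∈ ℝ | x ≤ r}` in the extended reals (so it is `+∞` at positive
infinite numbers and `-∞` at negative infinite ones). -/
noncomputable def st (x : LeviCivita) : EReal :=
  sInf {s : EReal | ∃ r : ℝ, x ≤ ofReal r ∧ s = (r : EReal)}

/-! ### Intervals, measurable sets, and their measure -/

/-- A bounded interval `I(a,b)`, with or without its endpoints. If `a = b` it is `∅` or `{a}`. -/
structure Interval where
  left : LeviCivita
  right : LeviCivita
  left_le_right : left ≤ right
  carrier : Set LeviCivita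
  Ioo_subset : Set.Ioo left right ⊆ carrier
  subset_Icc : carrier ⊆ Set.Icc left right

/-- The length `b - a`. -/
noncomputable def Interval.length (I : Interval) : LeviCivita := I.right - I.left

/-- The closed interval `[a,b]` with the same endpoints. -/
def Interval.closed (I : Interval) : Interval where
  left := I.left
  right := I.right
  left_le_right := I.left_le_right
  carrier := Set.Icc I.left I.right
  Ioo_subset := Set.Ioo_subset_Icc_self
  subset_Icc := subset_rfl

/-- The sequence of intervals is mutually disjoint. -/
def MutuallyDisjoint (I : ℕ → Interval) : Prop :=
  Pairwise fun m n => Disjoint (I m).carrier (I n).carrier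

/-- `∑ u n` strongly converges to `s`. -/
def SeriesTo (u : ℕ → LeviCivita) (s : LeviCivita) : Prop :=
  Tendsto (fun N => ∑ n ∈ Finset.range N, u n) atTop (𝓝 s)

/-- The sums of the lengths of disjoint sequences of intervals contained in `A`. -/
def lowerSums (A : Set LeviCivita) : Set LeviCivita :=
  {s | ∃ I : ℕ → Interval, MutuallyDisjoint I ∧ (⋃ n, (I n).carrier) ⊆ A ∧
    SeriesTo (fun n => (I n).length) s}

/-- The sums of the lengths of disjoint sequences of intervals covering `A`. -/
def upperSums (A : Set LeviCivita) : Set LeviCivita :=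
  {s | ∃ J : ℕ → Interval, MutuallyDisjoint J ∧ A ⊆ (⋃ n, (J n).carrier) ∧
    SeriesTo (fun n => (J n).length) s}

/-- Measurable subsets of the Levi-Civita field. -/
def MeasurableSubset (A : Set LeviCivita) : Prop :=
  ∀ ε : LeviCivita, 0 < ε → ∃ s ∈ lowerSums A, ∃ t ∈ upperSums A, t - s ≤ ε

/-- `μ` is the measure of `A`: the common value of the inner and the outer measure. -/
def IsMeasureOf (A : Set LeviCivita) (μ : LeviCivita) : Prop :=
  IsLUB (lowerSums A) μ ∧ IsGLB (upperSums A) μ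

/-! ### Simple functions and measurable functions -/

/-- The sequence `c` weakly converges to `l`. -/
def WeakTendsto (c : ℕ → LeviCivita) (l : LeviCivita) : Prop :=
  ∀ ε : ℝ, 0 < ε → ∃ n : ℕ, ∀ m : ℕ, n < m → ∀ q : ℚ, (q : ℝ) ≤ ε⁻¹ → |coeff (c m - l) q| < ε

/-- `f` is simple on `I`: it is there the sum of a power series, centred in the closed interval,
that weakly converges at every point of `I`. -/
def IsSimpleOn (f : LeviCivita → LeviCivita) (I : Interval) : Prop :=
  ∃ x₀ ∈ Set.Icc I.left I.right, ∃ a : ℕ → LeviCivita, ∀ x ∈ I.carrier,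
    WeakTendsto (fun N => ∑ n ∈ Finset.range N, a n * (x - x₀) ^ n) (f x)

/-- `f` is a measurable function on the (measurable) set `A`. Only the values on `A` matter. -/
def MeasurableFun (A : Set LeviCivita) (f : LeviCivita → LeviCivita) : Prop :=
  MeasurableSubset A ∧ ∃ μ, IsMeasureOf A μ ∧ ∀ ε : LeviCivita, 0 < ε →
    ∃ (I : ℕ → Interval) (s : LeviCivita), MutuallyDisjoint I ∧ (⋃ n, (I n).carrier) ⊆ A ∧
      SeriesTo (fun n => (I n).length) s ∧ μ - s < ε ∧ ∀ n, IsSimpleOn f (I n)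

/-! ### The integral with values in the Levi-Civita field -/

/-- `f` is the derivative of `F` on `I` (one-sided at endpoints belonging to `I`). -/
def IsDerivOn (F f : LeviCivita → LeviCivita) (I : Interval) : Prop :=
  ∀ x ∈ I.carrier, ∀ ε : LeviCivita, 0 < ε → ∃ δ : LeviCivita, 0 < δ ∧
    ∀ y ∈ I.carrier, |y - x| < δ → |F y - F x - f x * (y - x)| ≤ ε * |y - x|

/-- `v` is the integral over `I(a,b)` of the simple function `f`: `f` has an antiderivative `F`,
simple on `[a,b]`, and `v = lim_{x → b} F(x) - lim_{x → a} F(x)`. -/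
def HasSimpleIntegral (f : LeviCivita → LeviCivita) (I : Interval) (v : LeviCivita) : Prop :=
  IsSimpleOn f I ∧ ∃ F : LeviCivita → LeviCivita, IsSimpleOn F I.closed ∧ IsDerivOn F f I ∧
    ∃ α β : LeviCivita,
      Tendsto F (𝓝[Set.Icc I.left I.right] I.left) (𝓝 α) ∧
      Tendsto F (𝓝[Set.Icc I.left I.right] I.right) (𝓝 β) ∧ v = β - α

/-- The disjoint sequences of intervals contained in `A` on each of which `f` is simple. -/
def simpleFamilies (A : Set LeviCivita) (f : LeviCivita → LeviCivita) : Set (ℕ → Interval) :=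
  {I | MutuallyDisjoint I ∧ (⋃ n, (I n).carrier) ⊆ A ∧ ∀ n, IsSimpleOn f (I n)}

/-- The integral of the measurable function `f` over `A` is defined and equal to the element `v` of
the field: `v` is the limit of `∑ n, ∫_{I n} f` over the families `I` in `simpleFamilies A f` as
`∑ n, l(I n)` tends to the measure of `A`. -/
def HasIntegral (A : Set LeviCivita) (f : LeviCivita → LeviCivita) (v : LeviCivita) : Prop :=
  MeasurableFun A f ∧ ∃ μ, IsMeasureOf A μ ∧ ∀ ε : LeviCivita, 0 < ε →
    ∃ δ : LeviCivita, 0 < δ ∧ ∀ I ∈ simpleFamilies A f, ∀ s : LeviCivita,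
      SeriesTo (fun n => (I n).length) s → |μ - s| < δ →
        ∃ (σ : ℕ → LeviCivita) (t : LeviCivita), (∀ n, HasSimpleIntegral f (I n) (σ n)) ∧
          SeriesTo σ t ∧ |t - v| < ε

/-- `f ∈ L¹(A)`: `f` is measurable and the integral of `|f|` over `A` is defined and not `+∞`. -/
def MemL1 (A : Set LeviCivita) (f : LeviCivita → LeviCivita) : Prop :=
  MeasurableFun A f ∧ ∃ v, HasIntegral A (fun x => |f x|) v

/-! ### The real-valued integral -/

/-- `sup {st (∫_A g) | g ∈ L¹(A), g ≤ f on A}`. -/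
noncomputable def lowerMIntegral (A : Set LeviCivita) (f : LeviCivita → LeviCivita) : EReal :=
  sSup {r : EReal | ∃ g v, MemL1 A g ∧ (∀ x ∈ A, g x ≤ f x) ∧ HasIntegral A g v ∧ r = st v}

/-- `inf {st (∫_A g) | g ∈ L¹(A), g ≥ f on A}`. -/
noncomputable def upperMIntegral (A : Set LeviCivita) (f : LeviCivita → LeviCivita) : EReal :=
  sInf {r : EReal | ∃ g v, MemL1 A g ∧ (∀ x ∈ A, f x ≤ g x) ∧ HasIntegral A g v ∧ r = st v}

/-- `f` is bounded on `A`. -/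
def BoundedOn (A : Set LeviCivita) (f : LeviCivita → LeviCivita) : Prop :=
  ∃ M : LeviCivita, ∀ x ∈ A, |f x| ≤ M

/-- `M`-integrability of functions that are bounded or non-negative on `A`; their integral is
`lowerMIntegral A f`. -/
def BasicMIntegrable (A : Set LeviCivita) (f : LeviCivita → LeviCivita) : Prop :=
  (BoundedOn A f ∧ lowerMIntegral A f = upperMIntegral A f) ∨
    (¬ BoundedOn A f ∧ (∀ x ∈ A, 0 ≤ f x) ∧ lowerMIntegral A f < ⊤)

/-- Positive part. -/
noncomputable def pos (f : LeviCivita → LeviCivita) : LeviCivita → LeviCivita :=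
  fun x => max (f x) 0

/-- Negative part. -/
noncomputable def neg (f : LeviCivita → LeviCivita) : LeviCivita → LeviCivita :=
  fun x => max (-f x) 0

open scoped Classical in
/-- `f` is `M`-integrable over `A`. -/
def MIntegrable (A : Set LeviCivita) (f : LeviCivita → LeviCivita) : Prop :=
  if BoundedOn A f ∨ ∀ x ∈ A, 0 ≤ f x then BasicMIntegrable A f
  else if ∀ x ∈ A, f x ≤ 0 then BasicMIntegrable A (neg f)
  else BasicMIntegrable A (pos f) ∧ BasicMIntegrable A (neg f)

open scoped Classical in
/-- The `M`-integral of `f` over `A`, for `M`-integrable `f`. -/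
noncomputable def mIntegral (A : Set LeviCivita) (f : LeviCivita → LeviCivita) : EReal :=
  if BoundedOn A f ∨ ∀ x ∈ A, 0 ≤ f x then lowerMIntegral A f
  else if ∀ x ∈ A, f x ≤ 0 then -lowerMIntegral A (neg f)
  else lowerMIntegral A (pos f) - lowerMIntegral A (neg f)

end LC

/-!
On an interval normalized to have length of order one, weak convergence of a power series at all
points forces its coefficients to have a common left-finite support and to decrease, at each
exponent, faster than any power of the index: convergence at uncountably many real points gives the
support, convergence at points infinitely close to an endpoint gives the decay. Hence a simple
function can be expanded about the midpoint of its interval and integrated term by term, and its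
integral is monotone: at the least exponent at which the coefficients of an antiderivative along
the real points are not all constant, the coefficient is a real function of nonnegative derivative.

For an integrable function, the integrals over finite families of intervals of small total length
are small, and this property passes to every measurable function it dominates. Since the field is
complete, such a function is integrable too. So when `∫ |f|` is finite, `f` and its positive and
negative parts, which are measurable because `pos f = (|f| + f) / 2`, have finite integrals. The
integral of a function in `L¹` is attained in the supremum and in the infimum that define the lower
and the upper `M`-integral, and the standard part is additive on finite numbers.
-/

open scoped Pointwise

namespace LC

theorem LeftFinite.isPWO {S : Set ℚ} (h : LeftFinite S) : S.IsPWO := by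
  rw [Set.isPWO_iff_isWF, Set.isWF_iff_no_descending_seq]
  intro f hf hmem
  refine Set.infinite_range_of_injective hf.injective ((h (f 0)).subset ?_)
  rintro _ ⟨n, rfl⟩
  exact ⟨hmem n, hf.antitone (Nat.zero_le n)⟩

theorem LeftFinite.exists_le {S : Set ℚ} (h : LeftFinite S) : ∃ m : ℚ, ∀ q ∈ S, m ≤ q := by
  obtain ⟨m, hm⟩ := (h 0).bddBelow
  refine ⟨min m 0, fun q hq => ?_⟩
  rcases le_total q 0 with h0 | h0
  · exact (min_le_left _ _).trans (hm ⟨hq, h0⟩)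
  · exact (min_le_right _ _).trans h0

theorem LeftFinite.add {S T : Set ℚ} (hS : LeftFinite S) (hT : LeftFinite T) :
    LeftFinite (S + T) := by
  obtain ⟨a, ha⟩ := hS.exists_le
  obtain ⟨b, hb⟩ := hT.exists_le
  intro q
  refine ((hS (q - b)).add (hT (q - a))).subset ?_
  rintro g ⟨hg, hgq⟩
  obtain ⟨u, hu, v, hv, rfl⟩ := Set.mem_add.1 hg
  have hau := ha u hu
  have hbv := hb v hv
  exact Set.add_mem_add ⟨hu, by linarith⟩ ⟨hv, by linarith⟩

theorem coeff_add (x y : LeviCivita) (q : ℚ) : coeff (x + y) q = coeff x q + coeff y q := rfl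

theorem coeff_neg (x : LeviCivita) (q : ℚ) : coeff (-x) q = -coeff x q := rfl

theorem coeff_sub (x y : LeviCivita) (q : ℚ) : coeff (x - y) q = coeff x q - coeff y q := rfl

theorem coeff_zero (q : ℚ) : coeff 0 q = 0 := rfl

theorem coeff_sum {ι : Type*} (s : Finset ι) (f : ι → LeviCivita) (q : ℚ) :
    coeff (∑ i ∈ s, f i) q = ∑ i ∈ s, coeff (f i) q :=
  map_sum (⟨⟨fun x => coeff x q, coeff_zero q⟩, fun x y => coeff_add x y q⟩ : LeviCivita →+ ℝ) f s

theorem coeff_ext {x y : LeviCivita} (h : ∀ q, coeff x q = coeff y q) : x = y :=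
  Subtype.ext (HahnSeries.ext (funext h))

/-- The set `S` contains the support of the series `x`. -/
def HasSupp (S : Set ℚ) (x : LeviCivita) : Prop := ∀ q, coeff x q ≠ 0 → q ∈ S

theorem leftFinite_supp (x : LeviCivita) : LeftFinite {q | coeff x q ≠ 0} := x.2

theorem HasSupp.eq_zero {S : Set ℚ} {x : LeviCivita} (h : HasSupp S x) {q : ℚ} (hq : q ∉ S) :
    coeff x q = 0 := by
  by_contra h0
  exact hq (h q h0)

/-- The series with prescribed coefficients, which must have left-finite support. -/
noncomputable def ofFun (c : ℚ → ℝ) (h : LeftFinite (Function.support c)) : LeviCivita :=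
  ⟨toLex ⟨c, h.isPWO⟩, h⟩

theorem coeff_ofFun (c : ℚ → ℝ) (h : LeftFinite (Function.support c)) (q : ℚ) :
    coeff (ofFun c h) q = c q := rfl

theorem coeff_mul {S T : Set ℚ} (hS : LeftFinite S) (hT : LeftFinite T) {x y : LeviCivita}
    (hx : HasSupp S x) (hy : HasSupp T y) (q : ℚ) :
    coeff (x * y) q =
      ∑ ij ∈ Finset.antidiagonal hS.isPWO hT.isPWO q, coeff x ij.1 * coeff y ij.2 := by
  refine (HahnSeries.coeff_mul (x := ofLex (x : Lex (HahnSeries ℚ ℝ)))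
    (y := ofLex (y : Lex (HahnSeries ℚ ℝ)))).trans ?_
  refine Finset.sum_subset ?_ ?_
  · intro ij hij
    rw [Finset.mem_antidiagonal] at hij ⊢
    exact ⟨hx _ hij.1, hy _ hij.2.1, hij.2.2⟩
  · intro ij hij hn
    rw [Finset.mem_antidiagonal] at hij hn
    by_contra h0
    exact hn ⟨left_ne_zero_of_mul h0, right_ne_zero_of_mul h0, hij.2.2⟩

theorem HasSupp.mul {S T : Set ℚ} {x y : LeviCivita}
    (hx : HasSupp S x) (hy : HasSupp T y) : HasSupp (S + T) (x * y) := by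
  intro q hq
  rw [coeff_mul (leftFinite_supp x) (leftFinite_supp y) (fun _ h => h) (fun _ h => h)] at hq
  obtain ⟨ij, hij, -⟩ := Finset.exists_ne_zero_of_sum_ne_zero hq
  rw [Finset.mem_antidiagonal] at hij
  exact Set.mem_add.2 ⟨_, hx _ hij.1, _, hy _ hij.2.1, hij.2.2⟩

/-- The monomial `r d ^ q`, where `d` is the usual positive infinitesimal generator of the field. -/
noncomputable def monomial (q : ℚ) (r : ℝ) : LeviCivita :=
  ⟨toLex (HahnSeries.single q r), leftFinite_of_finite
    ((Set.finite_singleton q).subset HahnSeries.support_single_subset)⟩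

theorem coeff_monomial (p q : ℚ) (r : ℝ) : coeff (monomial p r) q = if q = p then r else 0 := by
  by_cases h : q = p
  · subst h
    rw [if_pos rfl]
    exact HahnSeries.coeff_single_same q r
  · rw [if_neg h]
    exact HahnSeries.coeff_single_of_ne h

theorem monomial_neg (q : ℚ) (r : ℝ) : monomial q (-r) = -monomial q r := coeff_ext fun p => by
  rw [coeff_neg, coeff_monomial, coeff_monomial]; split_ifs <;> simp

theorem ofReal_eq (r : ℝ) : ofReal r = monomial 0 r := rfl

theorem monomial_mul (p q : ℚ) (r s : ℝ) :
    monomial p r * monomial q s = monomial (p + q) (r * s) :=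
  Subtype.ext (HahnSeries.single_mul_single)

theorem coeff_monomial_mul (p q : ℚ) (r : ℝ) (x : LeviCivita) :
    coeff (monomial p r * x) q = r * coeff x (q - p) := by
  have h := HahnSeries.coeff_single_mul_add (r := r) (x := ofLex (x : Lex (HahnSeries ℚ ℝ)))
    (a := q - p) (b := p)
  rw [sub_add_cancel] at h
  exact h

theorem coeff_ofReal_mul (q : ℚ) (r : ℝ) (x : LeviCivita) :
    coeff (ofReal r * x) q = r * coeff x q := by
  rw [ofReal_eq, coeff_monomial_mul, sub_zero]

theorem coeff_ofReal (q : ℚ) (r : ℝ) : coeff (ofReal r) q = if q = 0 then r else 0 :=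
  coeff_monomial 0 q r

theorem ofReal_one : ofReal 1 = 1 := rfl

theorem ofReal_zero : ofReal 0 = 0 := coeff_ext fun q => by
  rw [coeff_ofReal, coeff_zero]; simp

/-- The embedding of the real numbers as a ring homomorphism. -/
noncomputable def ofRealHom : ℝ →+* LeviCivita where
  toFun := ofReal
  map_one' := ofReal_one
  map_mul' r s := by rw [ofReal_eq, ofReal_eq, ofReal_eq, monomial_mul, add_zero]
  map_zero' := ofReal_zero
  map_add' r s := coeff_ext fun q => by
    simp only [coeff_add, coeff_ofReal]; split_ifs <;> simp

theorem ofReal_add (r s : ℝ) : ofReal (r + s) = ofReal r + ofReal s := map_add ofRealHom r s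

theorem ofReal_mul (r s : ℝ) : ofReal (r * s) = ofReal r * ofReal s := map_mul ofRealHom r s

theorem ofReal_neg (r : ℝ) : ofReal (-r) = -ofReal r := map_neg ofRealHom r

theorem ofReal_sub (r s : ℝ) : ofReal (r - s) = ofReal r - ofReal s := map_sub ofRealHom r s

theorem ofReal_pow (r : ℝ) (n : ℕ) : ofReal (r ^ n) = ofReal r ^ n := map_pow ofRealHom r n

theorem ofReal_natCast (n : ℕ) : ofReal n = n := map_natCast ofRealHom n

theorem coeff_natCast_mul (n : ℕ) (x : LeviCivita) (q : ℚ) :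
    coeff (n * x) q = n * coeff x q := by
  rw [← ofReal_natCast, coeff_ofReal_mul]

theorem coeff_one (q : ℚ) : coeff 1 q = if q = 0 then 1 else 0 := coeff_ofReal q 1

theorem lt_iff_coeff {x y : LeviCivita} :
    x < y ↔ ∃ q, (∀ j < q, coeff x j = coeff y j) ∧ coeff x q < coeff y q :=
  HahnSeries.lt_iff (x : Lex (HahnSeries ℚ ℝ)) y

/-- The support of `x` lies in `[m, ∞)`; in terms of the infinitesimal generator `d` of the field,
`x` is `O(d ^ m)`. -/
def SuppGE (m : ℚ) (x : LeviCivita) : Prop := ∀ q < m, coeff x q = 0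

theorem SuppGE.mono {m m' : ℚ} {x : LeviCivita} (h : SuppGE m x) (hm : m' ≤ m) : SuppGE m' x :=
  fun q hq => h q (hq.trans_le hm)

theorem SuppGE.hasSupp {m : ℚ} {x : LeviCivita} (h : SuppGE m x) : HasSupp (Set.Ici m) x := by
  intro q hq
  by_contra hn
  exact hq (h q (not_le.1 hn))

theorem SuppGE.add {m : ℚ} {x y : LeviCivita} (hx : SuppGE m x) (hy : SuppGE m y) :
    SuppGE m (x + y) := fun q hq => by rw [coeff_add, hx q hq, hy q hq, add_zero]

theorem SuppGE.neg {m : ℚ} {x : LeviCivita} (hx : SuppGE m x) : SuppGE m (-x) :=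
  fun q hq => by rw [coeff_neg, hx q hq, neg_zero]

theorem SuppGE.sub {m : ℚ} {x y : LeviCivita} (hx : SuppGE m x) (hy : SuppGE m y) :
    SuppGE m (x - y) := by
  rw [sub_eq_add_neg]; exact hx.add hy.neg

theorem SuppGE.sum {ι : Type*} {m : ℚ} {s : Finset ι} {f : ι → LeviCivita}
    (h : ∀ i ∈ s, SuppGE m (f i)) : SuppGE m (∑ i ∈ s, f i) := fun q hq => by
  rw [coeff_sum]; exact Finset.sum_eq_zero fun i hi => h i hi q hq

theorem SuppGE.mul {a b : ℚ} {x y : LeviCivita} (hx : SuppGE a x) (hy : SuppGE b y) :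
    SuppGE (a + b) (x * y) := by
  intro q hq
  by_contra h0
  obtain ⟨u, hu, v, hv, h⟩ := Set.mem_add.1 (hx.hasSupp.mul hy.hasSupp q h0)
  have hau : a ≤ u := hu
  have hbv : b ≤ v := hv
  linarith

theorem suppGE_one : SuppGE 0 1 := fun q hq => by rw [coeff_one, if_neg hq.ne]

theorem suppGE_zero (m : ℚ) : SuppGE m 0 := fun _ _ => rfl

theorem suppGE_monomial (m : ℚ) (r : ℝ) : SuppGE m (monomial m r) := fun q hq => by
  rw [coeff_monomial, if_neg hq.ne]

theorem suppGE_ofReal (r : ℝ) : SuppGE 0 (ofReal r) := suppGE_monomial 0 r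

theorem SuppGE.pow {e : ℚ} {x : LeviCivita} (hx : SuppGE e x) (n : ℕ) :
    SuppGE (n * e) (x ^ n) := by
  induction n with
  | zero => simpa using suppGE_one
  | succ n ih =>
    rw [pow_succ]
    exact (ih.mul hx).mono (by push_cast; linarith)

theorem SuppGE.pow_zero {x : LeviCivita} (hx : SuppGE 0 x) (n : ℕ) : SuppGE 0 (x ^ n) := by
  simpa using hx.pow n

theorem pos_iff {x : LeviCivita} : 0 < x ↔ ∃ q, SuppGE q x ∧ 0 < coeff x q := by
  rw [lt_iff_coeff]
  refine exists_congr fun q => and_congr ?_ Iff.rfl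
  exact forall₂_congr fun j _ => eq_comm

theorem coeff_nonneg_of_nonneg {m : ℚ} {x : LeviCivita} (hx : 0 ≤ x) (h : SuppGE m x) :
    0 ≤ coeff x m := by
  by_contra hn
  exact absurd hx (not_le.2 (lt_iff_coeff.2 ⟨m, h, not_le.1 hn⟩))

theorem SuppGE.of_nonneg_of_le {m : ℚ} {x y : LeviCivita} (hx : 0 ≤ x) (hxy : x ≤ y)
    (hy : SuppGE m y) : SuppGE m x := by
  rcases hx.eq_or_lt with rfl | hx
  · exact suppGE_zero m
  obtain ⟨q, hlow, hpos⟩ := pos_iff.1 hx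
  refine hlow.mono ?_
  by_contra! hq
  refine absurd hxy (not_le.2 (lt_iff_coeff.2 ⟨q, fun j hj => ?_, ?_⟩))
  · rw [hlow j hj, hy j (hj.trans hq)]
  · rwa [hy q hq]

theorem suppGE_abs {m : ℚ} {x : LeviCivita} : SuppGE m |x| ↔ SuppGE m x := by
  rcases abs_choice x with h | h <;> rw [h]
  exact ⟨fun hx => neg_neg x ▸ hx.neg, SuppGE.neg⟩

theorem SuppGE.of_abs_le {m : ℚ} {x y : LeviCivita} (hxy : |x| ≤ y) (hy : SuppGE m y) :
    SuppGE m x :=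
  suppGE_abs.1 (hy.of_nonneg_of_le (abs_nonneg x) hxy)

theorem monomial_pos (m : ℚ) {r : ℝ} (hr : 0 < r) : 0 < monomial m r :=
  pos_iff.2 ⟨m, suppGE_monomial m r, by rwa [coeff_monomial, if_pos rfl]⟩

theorem SuppGE.abs_lt_monomial {m m' : ℚ} {x : LeviCivita} (hx : SuppGE m x) (h : m' < m)
    {r : ℝ} (hr : 0 < r) : |x| < monomial m' r := by
  refine lt_iff_coeff.2 ⟨m', fun j hj => ?_, ?_⟩
  · rw [suppGE_abs.2 hx j (hj.trans h), suppGE_monomial m' r j hj]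
  · rw [suppGE_abs.2 hx m' h, coeff_monomial, if_pos rfl]
    exact hr

theorem exists_suppGE_lt {ε : LeviCivita} (hε : 0 < ε) :
    ∃ m : ℚ, ∀ x, SuppGE m x → |x| < ε := by
  obtain ⟨q, hbelow, hq⟩ := pos_iff.1 hε
  refine ⟨q + 1, fun x hx => lt_iff_coeff.2 ⟨q, fun j hj => ?_, ?_⟩⟩
  · rw [suppGE_abs.2 hx j (by linarith), hbelow j hj]
  · rwa [suppGE_abs.2 hx q (by linarith)]

theorem suppGE_of_abs_le_ofReal {r : ℝ} {x : LeviCivita} (h : |x| ≤ ofReal r) : SuppGE 0 x :=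
  SuppGE.of_abs_le h (suppGE_ofReal r)

theorem abs_coeff_le_of_abs_le {r : ℝ} {x : LeviCivita} (h : |x| ≤ ofReal r) :
    |coeff x 0| ≤ r := by
  have hx := suppGE_of_abs_le_ofReal h
  have hupper := coeff_nonneg_of_nonneg (sub_nonneg.2 (le_of_abs_le h)) ((suppGE_ofReal r).sub hx)
  have hlower := coeff_nonneg_of_nonneg (neg_le_iff_add_nonneg'.1 (neg_le_of_abs_le h))
    ((suppGE_ofReal r).add hx)
  rw [coeff_sub, coeff_ofReal, if_pos rfl] at hupper
  rw [coeff_add, coeff_ofReal, if_pos rfl] at hlower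
  exact abs_le.2 ⟨by linarith, by linarith⟩

theorem ofReal_le {r s : ℝ} (h : r ≤ s) : ofReal r ≤ ofReal s := by
  rcases h.eq_or_lt with rfl | h
  · exact le_rfl
  · rw [← sub_nonneg, ← ofReal_sub]
    exact (monomial_pos 0 (sub_pos.2 h)).le

theorem ofReal_lt {r s : ℝ} (h : r < s) : ofReal r < ofReal s := by
  rw [← sub_pos, ← ofReal_sub]
  exact monomial_pos 0 (sub_pos.2 h)

theorem tendsto_zero_iff {u : ℕ → LeviCivita} :
    Tendsto u atTop (𝓝 0) ↔ ∀ m : ℚ, ∀ᶠ n in atTop, SuppGE m (u n) := by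
  rw [LinearOrderedAddCommGroup.tendsto_nhds]
  constructor
  · intro h m
    filter_upwards [h (monomial m 1) (monomial_pos m one_pos)] with n hn
    rw [sub_zero] at hn
    exact SuppGE.of_abs_le hn.le (suppGE_monomial m 1)
  · intro h ε hε
    obtain ⟨m, hm⟩ := exists_suppGE_lt hε
    filter_upwards [h m] with n hn
    rw [sub_zero]
    exact hm _ hn

theorem exists_tendsto_of_suppGE_sub {S : ℕ → LeviCivita}
    (h : ∀ m : ℚ, ∃ N, ∀ n ≥ N, SuppGE m (S n - S N)) : ∃ l, Tendsto S atTop (𝓝 l) := by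
  choose N hN using h
  have hagree : ∀ q m : ℚ, q < m → ∀ n ≥ N m, coeff (S n) q = coeff (S (N (q + 1))) q := by
    intro q m hqm n hn
    have e1 := hN m n hn q hqm
    have e2 := hN m (max (N m) (N (q + 1))) (le_max_left _ _) q hqm
    have e3 := hN (q + 1) (max (N m) (N (q + 1))) (le_max_right _ _) q (by linarith)
    rw [coeff_sub] at e1 e2 e3
    linarith
  have hlf : LeftFinite (Function.support fun q => coeff (S (N (q + 1))) q) := by
    intro q
    refine ((leftFinite_supp (S (N (q + 1)))) q).subset ?_
    rintro g ⟨hg, hgq⟩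
    refine ⟨?_, hgq⟩
    have : coeff (S (N (q + 1))) g = coeff (S (N (g + 1))) g :=
      hagree g (q + 1) (by linarith) _ le_rfl
    exact fun h0 => hg (this.symm.trans h0)
  refine ⟨ofFun _ hlf, ?_⟩
  rw [← tendsto_sub_nhds_zero_iff, tendsto_zero_iff]
  intro m
  filter_upwards [eventually_ge_atTop (N m)] with n hn q hq
  rw [coeff_sub, coeff_ofFun, hagree q m hq n hn, sub_self]

theorem tendsto_monomial_natCast_atTop : Tendsto (fun n : ℕ => monomial n 1) atTop (𝓝 0) :=
  tendsto_zero_iff.2 fun m => by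
    filter_upwards [tendsto_natCast_atTop_atTop.eventually_ge_atTop m] with n hn
    exact (suppGE_monomial n 1).mono hn

theorem exists_seriesTo {u : ℕ → LeviCivita} (h : Tendsto u atTop (𝓝 0)) :
    ∃ s, SeriesTo u s := by
  refine exists_tendsto_of_suppGE_sub fun m => ?_
  obtain ⟨N, hN⟩ := eventually_atTop.1 (tendsto_zero_iff.1 h m)
  refine ⟨N, fun n hn => ?_⟩
  rw [← Finset.sum_Ico_eq_sub _ hn]
  exact SuppGE.sum fun i hi => hN i (Finset.mem_Ico.1 hi).1

theorem tendsto_zero_of_tendsto_sum_range {G : Type*} [AddCommGroup G] [TopologicalSpace G]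
    [IsTopologicalAddGroup G] {u : ℕ → G} {s : G}
    (h : Tendsto (fun N => ∑ n ∈ Finset.range N, u n) atTop (𝓝 s)) : Tendsto u atTop (𝓝 0) := by
  have hdiff := (h.comp (tendsto_add_atTop_nat 1)).sub h
  rw [sub_self] at hdiff
  refine hdiff.congr fun n => ?_
  simp [Finset.sum_range_succ]

theorem SeriesTo.tendsto_zero {u : ℕ → LeviCivita} {s : LeviCivita} (h : SeriesTo u s) :
    Tendsto u atTop (𝓝 0) :=
  tendsto_zero_of_tendsto_sum_range h

/-! ### Weak convergence -/

theorem WeakTendsto.tendsto_coeff {c : ℕ → LeviCivita} {l : LeviCivita} (h : WeakTendsto c l)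
    (q : ℚ) : Tendsto (fun n => coeff (c n) q) atTop (𝓝 (coeff l q)) := by
  rw [Metric.tendsto_atTop]
  intro ε hε
  have hb : (0 : ℝ) < |(q : ℝ)| + 1 := by positivity
  obtain ⟨n, hn⟩ := h (min ε (|(q : ℝ)| + 1)⁻¹) (lt_min hε (inv_pos.2 hb))
  refine ⟨n + 1, fun m hm => ?_⟩
  have hclose := hn m hm q ?_
  · rw [coeff_sub] at hclose
    exact hclose.trans_le (min_le_left _ _)
  · have hcutoff : |(q : ℝ)| + 1 ≤ (min ε (|(q : ℝ)| + 1)⁻¹)⁻¹ := by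
      rw [← inv_inv (|(q : ℝ)| + 1)]
      exact inv_anti₀ (lt_min hε (by positivity)) (by rw [inv_inv]; exact min_le_right _ _)
    linarith [le_abs_self (q : ℝ)]

theorem WeakTendsto.unique {c : ℕ → LeviCivita} {l l' : LeviCivita} (h : WeakTendsto c l)
    (h' : WeakTendsto c l') : l = l' :=
  coeff_ext fun q => tendsto_nhds_unique (h.tendsto_coeff q) (h'.tendsto_coeff q)

theorem WeakTendsto.add {c c' : ℕ → LeviCivita} {l l' : LeviCivita} (h : WeakTendsto c l)
    (h' : WeakTendsto c' l') : WeakTendsto (fun n => c n + c' n) (l + l') := by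
  intro ε hε
  obtain ⟨n, hn⟩ := h (ε / 2) (half_pos hε)
  obtain ⟨n', hn'⟩ := h' (ε / 2) (half_pos hε)
  refine ⟨max n n', fun m hm q hq => ?_⟩
  have hq' : (q : ℝ) ≤ (ε / 2)⁻¹ :=
    hq.trans (inv_anti₀ (half_pos hε) (half_le_self hε.le))
  have hclose := hn m ((le_max_left _ _).trans_lt hm) q hq'
  have hclose' := hn' m ((le_max_right _ _).trans_lt hm) q hq'
  rw [add_sub_add_comm, coeff_add]
  linarith [abs_add_le (coeff (c m - l) q) (coeff (c' m - l') q)]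

theorem WeakTendsto.ofReal_mul {c : ℕ → LeviCivita} {l : LeviCivita} {r : ℝ} (hr : |r| ≤ 1)
    (h : WeakTendsto c l) : WeakTendsto (fun n => ofReal r * c n) (ofReal r * l) := by
  intro ε hε
  obtain ⟨n, hn⟩ := h ε hε
  refine ⟨n, fun m hm q hq => ?_⟩
  rw [← mul_sub, coeff_ofReal_mul, abs_mul]
  exact (mul_le_of_le_one_left (abs_nonneg _) hr).trans_lt (hn m hm q hq)

theorem exists_nat_lt_mul (q : ℚ) {e : ℚ} (he : 0 < e) : ∃ K : ℕ, q < (K + 1) * e := by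
  obtain ⟨K, hK⟩ := exists_nat_gt (q / e)
  rw [div_lt_iff₀ he] at hK
  exact ⟨K, by linarith⟩

/-- A family is regular if its members have their supports in a common left-finite set. For
regular families weak convergence is convergence at each exponent. -/
def Regular {ι : Type*} (w : ι → LeviCivita) : Prop := ∃ S, LeftFinite S ∧ ∀ i, HasSupp S (w i)

theorem Regular.add {ι : Type*} {w w' : ι → LeviCivita} (h : Regular w) (h' : Regular w') :
    Regular fun i => w i + w' i := by
  obtain ⟨S, hS, hw⟩ := h
  obtain ⟨S', hS', hw'⟩ := h'
  refine ⟨S ∪ S', hS.union hS', fun i q hq => ?_⟩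
  by_contra hn
  rw [Set.mem_union, not_or] at hn
  exact hq (by rw [coeff_add, (hw i).eq_zero hn.1, (hw' i).eq_zero hn.2, add_zero])

theorem regular_pow {e : ℚ} {θ : LeviCivita} (he : 0 < e) (hθ : SuppGE e θ) :
    Regular fun n : ℕ => θ ^ n := by
  refine ⟨{q | ∃ n : ℕ, coeff (θ ^ n) q ≠ 0}, fun r => ?_, fun n q hq => ⟨n, hq⟩⟩
  obtain ⟨K, hK⟩ := exists_nat_lt_mul r he
  refine ((Finset.range (K + 1)).finite_toSet.biUnion fun m _ =>
    leftFinite_supp (θ ^ m) r).subset ?_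
  rintro q ⟨⟨m, hm⟩, hqr⟩
  refine Set.mem_biUnion (x := m) ?_ ⟨hm, hqr⟩
  rw [Finset.mem_coe, Finset.mem_range]
  by_contra hmK
  have hKm : (K : ℚ) + 1 ≤ m := by exact_mod_cast not_lt.1 hmK
  exact hm (hθ.pow m q (hqr.trans_lt (hK.trans_le (by gcongr))))

/-- The regular family `w` sums up to `s` at each exponent. -/
structure HasWSum {ι : Type*} (w : ι → LeviCivita) (s : LeviCivita) : Prop where
  regular : Regular w
  hasSum : ∀ q, HasSum (fun i => coeff (w i) q) (coeff s q)

namespace HasWSum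

variable {ι κ : Type*} {w w' : ι → LeviCivita} {s s' : LeviCivita}

theorem unique (h : HasWSum w s) (h' : HasWSum w s') : s = s' :=
  coeff_ext fun q => (h.hasSum q).unique (h'.hasSum q)

theorem hasSupp (h : HasWSum w s) {S : Set ℚ} (hS : ∀ i, HasSupp S (w i)) : HasSupp S s := by
  intro q hq
  by_contra hn
  apply hq
  have hsum := h.hasSum q
  have hzero : (fun i => coeff (w i) q) = fun _ => 0 := funext fun i => (hS i).eq_zero hn
  rw [hzero] at hsum
  exact hsum.unique hasSum_zero

theorem suppGE (h : HasWSum w s) {m : ℚ} (hm : ∀ i, SuppGE m (w i)) : SuppGE m s := fun q hq =>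
  (h.hasSupp (fun i => (hm i).hasSupp)).eq_zero (by simpa using hq)

theorem add (h : HasWSum w s) (h' : HasWSum w' s') : HasWSum (fun i => w i + w' i) (s + s') :=
  ⟨h.regular.add h'.regular, fun q => (h.hasSum q).add (h'.hasSum q)⟩

theorem mul_left (c : LeviCivita) (h : HasWSum w s) : HasWSum (fun i => c * w i) (c * s) := by
  obtain ⟨S, hS, hw⟩ := h.regular
  have hc := leftFinite_supp c
  refine ⟨⟨_, hc.add hS, fun i => HasSupp.mul (fun _ h => h) (hw i)⟩, fun q => ?_⟩
  simp only [coeff_mul hc hS (fun _ h => h) (hw _), coeff_mul hc hS (fun _ h => h) (h.hasSupp hw)]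
  exact hasSum_sum fun ij _ => (h.hasSum ij.2).mul_left _

theorem prod_fiberwise {w : ι × κ → LeviCivita} {r : ι → LeviCivita} (h : HasWSum w s)
    (hr : ∀ i, HasWSum (fun k => w (i, k)) (r i)) : HasWSum r s := by
  obtain ⟨S, hS, hw⟩ := h.regular
  exact ⟨⟨S, hS, fun i => (hr i).hasSupp fun k => hw (i, k)⟩,
    fun q => (h.hasSum q).prod_fiberwise fun i => (hr i).hasSum q⟩

theorem swap {w : ι × κ → LeviCivita} (h : HasWSum w s) :
    HasWSum (fun p : κ × ι => w p.swap) s := by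
  obtain ⟨S, hS, hw⟩ := h.regular
  exact ⟨⟨S, hS, fun i => hw _⟩, fun q => (Equiv.prodComm κ ι).hasSum_iff.2 (h.hasSum q)⟩

theorem weakTendsto {w : ℕ → LeviCivita} (h : HasWSum w s) :
    WeakTendsto (fun N => ∑ n ∈ Finset.range N, w n) s := by
  obtain ⟨S, hS, hw⟩ := h.regular
  intro ε hε
  obtain ⟨r, hr⟩ := exists_nat_gt ε⁻¹
  have hev : ∀ᶠ N in atTop, ∀ q ∈ {x ∈ S | x ≤ (r : ℚ)},
      |coeff ((∑ n ∈ Finset.range N, w n) - s) q| < ε := by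
    rw [(hS r).eventually_all]
    intro q _
    have hsum := (h.hasSum q).tendsto_sum_nat
    filter_upwards [Metric.tendsto_nhds.1 hsum ε hε] with N hN
    rwa [coeff_sub, coeff_sum]
  obtain ⟨n, hn⟩ := eventually_atTop.1 hev
  refine ⟨n, fun m hm q hq => ?_⟩
  by_cases hqS : q ∈ S
  · refine hn m hm.le q ⟨hqS, ?_⟩
    have : (q : ℝ) ≤ r := hq.trans hr.le
    exact_mod_cast this
  · rw [coeff_sub, coeff_sum, (h.hasSupp hw).eq_zero hqS,
      Finset.sum_eq_zero fun i _ => (hw i).eq_zero hqS]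
    simpa using hε

end HasWSum

theorem exists_hasWSum {ι : Type*} {w : ι → LeviCivita} {S : Set ℚ} (hS : LeftFinite S)
    (hw : ∀ i, HasSupp S (w i)) (h : ∀ q, Summable fun i => coeff (w i) q) :
    ∃ s, HasWSum w s := by
  have hlf : LeftFinite (Function.support fun q => ∑' i, coeff (w i) q) := by
    refine hS.mono fun q hq => ?_
    by_contra hn
    apply hq
    simp only [(hw _).eq_zero hn, tsum_zero]
  exact ⟨ofFun _ hlf, ⟨S, hS, hw⟩, fun q => (h q).hasSum⟩

/-- The series `b` dominates `x`: its coefficients dominate the absolute values of those of `x`.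
Domination, unlike the order of the field, is what makes rearrangements of series possible. -/
def Dom (x b : LeviCivita) : Prop := ∀ q, |coeff x q| ≤ coeff b q

namespace Dom

variable {x y b c : LeviCivita}

theorem nonneg (h : Dom x b) (q : ℚ) : 0 ≤ coeff b q := (abs_nonneg _).trans (h q)

theorem refl_of_nonneg (h : ∀ q, 0 ≤ coeff b q) : Dom b b := fun q => (abs_of_nonneg (h q)).le

theorem refl_right (h : Dom x b) : Dom b b := refl_of_nonneg h.nonneg

theorem trans (h : Dom x b) (h' : Dom b c) : Dom x c := fun q =>
  (h q).trans ((le_abs_self _).trans (h' q))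

theorem hasSupp (h : Dom x b) {S : Set ℚ} (hb : HasSupp S b) : HasSupp S x := by
  intro q hq
  refine hb q fun h0 => hq ?_
  have := h q
  rw [h0] at this
  exact abs_nonpos_iff.1 this

theorem suppGE (h : Dom x b) {m : ℚ} (hb : SuppGE m b) : SuppGE m x := fun q hq =>
  (h.hasSupp hb.hasSupp).eq_zero (by simpa using hq)

theorem add (h : Dom x b) (h' : Dom y c) : Dom (x + y) (b + c) := fun q => by
  rw [coeff_add, coeff_add]
  exact (abs_add_le _ _).trans (add_le_add (h q) (h' q))

theorem mul (h : Dom x b) (h' : Dom y c) : Dom (x * y) (b * c) := fun q => by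
  have hb := leftFinite_supp b
  have hc := leftFinite_supp c
  rw [coeff_mul hb hc (h.hasSupp fun _ h => h) (h'.hasSupp fun _ h => h),
    coeff_mul hb hc (fun _ h => h) (fun _ h => h)]
  refine (Finset.abs_sum_le_sum_abs _ _).trans (Finset.sum_le_sum fun ij _ => ?_)
  rw [abs_mul]
  exact mul_le_mul (h _) (h' _) (abs_nonneg _) (h.nonneg _)

theorem one : Dom 1 1 := refl_of_nonneg fun q => by rw [coeff_one]; split_ifs <;> simp

theorem pow (h : Dom x b) (n : ℕ) : Dom (x ^ n) (b ^ n) := by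
  induction n with
  | zero => simpa using one
  | succ n ih => rw [pow_succ, pow_succ]; exact ih.mul h

end Dom

/-- The coefficientwise absolute value, the least series dominating `x`; it is unrelated to the
absolute value `|x|` of the ordered field. -/
noncomputable def absC (x : LeviCivita) : LeviCivita :=
  ofFun (fun q => |coeff x q|) ((leftFinite_supp x).mono fun _ h => abs_ne_zero.1 h)

theorem coeff_absC (x : LeviCivita) (q : ℚ) : coeff (absC x) q = |coeff x q| := rfl

theorem dom_absC (x : LeviCivita) : Dom x (absC x) := fun _ => le_rfl

theorem SuppGE.absC {m : ℚ} {x : LeviCivita} (h : SuppGE m x) : SuppGE m (absC x) := fun q hq => by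
  rw [coeff_absC, h q hq, abs_zero]

theorem HasSupp.absC {S : Set ℚ} {x : LeviCivita} (h : HasSupp S x) : HasSupp S (absC x) :=
  fun q hq => h q (abs_ne_zero.1 hq)

theorem HasWSum.of_dom {ι : Type*} {w b : ι → LeviCivita} {B : LeviCivita} (hb : HasWSum b B)
    (h : ∀ i, Dom (w i) (b i)) : ∃ s, HasWSum w s ∧ Dom s B := by
  obtain ⟨S, hS, hbS⟩ := hb.regular
  have habs : ∀ q, Summable fun i => |coeff (w i) q| := fun q =>
    Summable.of_nonneg_of_le (fun i => abs_nonneg _) (fun i => h i q) (hb.hasSum q).summable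
  obtain ⟨s, hs⟩ := exists_hasWSum hS (fun i => (h i).hasSupp (hbS i))
    fun q => (habs q).of_abs
  exact ⟨s, hs, fun q => (hs.hasSum q).norm_le_of_bounded (hb.hasSum q) fun i => h i q⟩

/-! ### Rapidly decreasing sequences -/

/-- A regular sequence that decreases, at each exponent, faster than any power of the index. -/
structure Rapid (v : ℕ → LeviCivita) : Prop where
  regular : Regular v
  summable : ∀ q (k : ℕ), Summable fun n : ℕ => ((n : ℝ) + 1) ^ k * |coeff (v n) q|

/-- A regular sequence that is bounded, at each exponent, by a polynomial in the index. -/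
structure PolyGrowth (y : ℕ → LeviCivita) : Prop where
  regular : Regular y
  bound : ∀ q, ∃ (C : ℝ) (K : ℕ), ∀ n : ℕ, |coeff (y n) q| ≤ C * ((n : ℝ) + 1) ^ K

theorem Rapid.of_dom {v b : ℕ → LeviCivita} (hb : Rapid b) (h : ∀ n, Dom (v n) (b n)) :
    Rapid v := by
  obtain ⟨S, hS, hbS⟩ := hb.regular
  refine ⟨⟨S, hS, fun n => (h n).hasSupp (hbS n)⟩, fun q k => ?_⟩
  refine Summable.of_nonneg_of_le (fun n => by positivity) (fun n => ?_) (hb.summable q k)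
  exact mul_le_mul_of_nonneg_left ((h n q).trans (le_abs_self _)) (by positivity)

theorem Rapid.absC {v : ℕ → LeviCivita} (hv : Rapid v) : Rapid fun n => absC (v n) := by
  obtain ⟨S, hS, hvS⟩ := hv.regular
  refine ⟨⟨S, hS, fun n => (hvS n).absC⟩, fun q k => ?_⟩
  simpa only [coeff_absC, abs_abs] using hv.summable q k

theorem Rapid.exists_hasWSum {v : ℕ → LeviCivita} (hv : Rapid v) : ∃ s, HasWSum v s := by
  obtain ⟨S, hS, hvS⟩ := hv.regular
  refine LC.exists_hasWSum hS hvS fun q => ?_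
  have := hv.summable q 0
  simp only [pow_zero, one_mul] at this
  exact this.of_abs

theorem Rapid.mul_polyGrowth {v y : ℕ → LeviCivita} (hv : Rapid v) (hy : PolyGrowth y) :
    Rapid fun n => v n * y n := by
  obtain ⟨S, hS, hvS⟩ := hv.regular
  obtain ⟨T, hT, hyT⟩ := hy.regular
  refine ⟨⟨_, hS.add hT, fun n => (hvS n).mul (hyT n)⟩, fun q k => ?_⟩
  choose C K hCK using hy.bound
  refine Summable.of_nonneg_of_le (fun n => by positivity) (fun n => ?_)
    (summable_sum (s := Finset.antidiagonal hS.isPWO hT.isPWO q) fun ij _ =>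
      (hv.summable ij.1 (k + K ij.2)).mul_left (C ij.2))
  rw [coeff_mul hS hT (hvS n) (hyT n)]
  refine (mul_le_mul_of_nonneg_left (Finset.abs_sum_le_sum_abs _ _) (by positivity)).trans ?_
  rw [Finset.mul_sum]
  refine Finset.sum_le_sum fun ij _ => ?_
  rw [abs_mul, pow_add]
  calc ((n : ℝ) + 1) ^ k * (|coeff (v n) ij.1| * |coeff (y n) ij.2|)
      ≤ ((n : ℝ) + 1) ^ k * (|coeff (v n) ij.1| * (C ij.2 * ((n : ℝ) + 1) ^ K ij.2)) := by
        gcongr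
        exact hCK _ n
    _ = _ := by ring

theorem PolyGrowth.mul_natCast_pow {y : ℕ → LeviCivita} (hy : PolyGrowth y) (j : ℕ) :
    PolyGrowth fun n => ((n + 1) ^ j : ℕ) * y n := by
  obtain ⟨T, hT, hyT⟩ := hy.regular
  refine ⟨⟨T, hT, fun n q hq => hyT n q fun h0 => hq ?_⟩, fun q => ?_⟩
  · rw [coeff_natCast_mul, h0, mul_zero]
  · obtain ⟨C, K, h⟩ := hy.bound q
    refine ⟨C, j + K, fun n => ?_⟩
    rw [coeff_natCast_mul, abs_mul, Nat.abs_cast, pow_add]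
    push_cast
    calc ((n : ℝ) + 1) ^ j * |coeff (y n) q| ≤ ((n : ℝ) + 1) ^ j * (C * ((n : ℝ) + 1) ^ K) := by
          gcongr; exact h n
      _ = _ := by ring

/-- `Z = 1 + θ` with `θ` infinitesimal and of nonnegative coefficients. Every `z` with `|z| ≤ 1` is
dominated by such a `Z`, whose powers grow polynomially at each exponent. -/
def NearOne (Z : LeviCivita) : Prop :=
  ∃ (θ : LeviCivita) (e : ℚ), 0 < e ∧ SuppGE e θ ∧ (∀ q, 0 ≤ coeff θ q) ∧ Z = 1 + θ

theorem sum_range_choose_mul_eq {R : Type*} [CommSemiring R] {a : ℕ → R} {K : ℕ}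
    (ha : ∀ m, K ≤ m → a m = 0) (n : ℕ) :
    ∑ m ∈ Finset.range (n + 1), n.choose m * a m = ∑ m ∈ Finset.range K, n.choose m * a m := by
  have hn : Finset.range (n + 1) ⊆ Finset.range (n + 1 + K) :=
    Finset.range_subset_range.2 (by omega)
  have hK : Finset.range K ⊆ Finset.range (n + 1 + K) := Finset.range_subset_range.2 (by omega)
  rw [Finset.sum_subset hn, Finset.sum_subset hK]
  · intro m _ hm
    rw [ha m (not_lt.1 (Finset.mem_range.not.1 hm)), mul_zero]
  · intro m _ hm
    rw [Nat.choose_eq_zero_of_lt (by simpa using hm), Nat.cast_zero, zero_mul]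

theorem coeff_mul_one_add_pow {x θ : LeviCivita} {a e q : ℚ} {K : ℕ} (hx : SuppGE a x)
    (hθ : SuppGE e θ) (he : 0 ≤ e) (hK : q < a + K * e) (n : ℕ) :
    coeff (x * (1 + θ) ^ n) q =
      ∑ m ∈ Finset.range K, (n.choose m : ℝ) * coeff (x * θ ^ m) q := by
  have hvanish : ∀ m, K ≤ m → coeff (x * θ ^ m) q = 0 := fun m hm =>
    hx.mul (hθ.pow m) q (hK.trans_le (by gcongr))
  rw [← sum_range_choose_mul_eq hvanish, add_comm 1, add_pow, Finset.mul_sum, coeff_sum]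
  refine Finset.sum_congr rfl fun m _ => ?_
  rw [← coeff_natCast_mul]
  congr 1
  ring

theorem NearOne.polyGrowth {Z : LeviCivita} (hZ : NearOne Z) : PolyGrowth fun n => Z ^ n := by
  obtain ⟨θ, e, he, hθ, -, rfl⟩ := hZ
  have hcoeff : ∀ q, ∃ K : ℕ, ∀ n : ℕ, coeff ((1 + θ) ^ n) q =
      ∑ m ∈ Finset.range (K + 1), (n.choose m : ℝ) * coeff (θ ^ m) q := by
    intro q
    obtain ⟨K, hK⟩ := exists_nat_lt_mul q he
    refine ⟨K, fun n => ?_⟩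
    simpa only [one_mul] using
      coeff_mul_one_add_pow suppGE_one hθ he.le (K := K + 1) (by push_cast; linarith) n
  obtain ⟨S, hS, hθS⟩ := regular_pow he hθ
  refine ⟨⟨S, hS, fun n q hq => ?_⟩, fun q => ?_⟩ <;> obtain ⟨K, hK⟩ := hcoeff q
  · rw [hK] at hq
    obtain ⟨m, -, hm⟩ := Finset.exists_ne_zero_of_sum_ne_zero hq
    exact hθS m q (right_ne_zero_of_mul hm)
  · refine ⟨∑ m ∈ Finset.range (K + 1), |coeff (θ ^ m) q|, K, fun n => ?_⟩
    rw [hK, Finset.sum_mul]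
    refine (Finset.abs_sum_le_sum_abs _ _).trans (Finset.sum_le_sum fun m hm => ?_)
    rw [abs_mul, Nat.abs_cast, mul_comm]
    refine mul_le_mul_of_nonneg_left ?_ (abs_nonneg _)
    calc (n.choose m : ℝ) ≤ (n : ℝ) ^ m := by exact_mod_cast Nat.choose_le_pow n m
      _ ≤ ((n : ℝ) + 1) ^ m := by gcongr; linarith
      _ ≤ ((n : ℝ) + 1) ^ K := by
        have hmK := Nat.lt_succ_iff.1 (Finset.mem_range.1 hm)
        gcongr
        linarith [n.cast_nonneg (α := ℝ)]

theorem LeftFinite.exists_gap {S : Set ℚ} (hS : LeftFinite S) :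
    ∃ e : ℚ, 0 < e ∧ ∀ q ∈ S, 0 < q → e ≤ q := by
  have hfin : {x ∈ {x ∈ S | x ≤ 1} | 0 < x}.Finite := (hS 1).subset fun x hx => hx.1
  rcases Set.eq_empty_or_nonempty {x ∈ {x ∈ S | x ≤ 1} | 0 < x} with h | h
  · refine ⟨1, one_pos, fun q hq h0 => ?_⟩
    by_contra! hlt
    have : q ∈ {x ∈ {x ∈ S | x ≤ 1} | 0 < x} := ⟨⟨hq, hlt.le⟩, h0⟩
    rw [h] at this
    exact this
  · obtain ⟨m, hm, hmin⟩ := Set.exists_min_image _ id hfin h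
    refine ⟨m, hm.2, fun q hq h0 => ?_⟩
    rcases le_total q 1 with h1 | h1
    · exact hmin q ⟨⟨hq, h1⟩, h0⟩
    · exact hm.1.2.trans h1

theorem exists_nearOne_dom {b : LeviCivita} (hb : SuppGE 0 b) (h0 : ∀ q, 0 ≤ coeff b q)
    (h1 : coeff b 0 ≤ 1) : ∃ Z, NearOne Z ∧ Dom b Z := by
  have hlf : LeftFinite (Function.support fun q => if q ≤ 0 then 0 else coeff b q) := by
    refine (leftFinite_supp b).mono fun q hq => ?_
    rw [Function.mem_support] at hq
    split_ifs at hq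
    · exact absurd rfl hq
    · exact hq
  obtain ⟨e, he, hgap⟩ := (leftFinite_supp b).exists_gap
  refine ⟨1 + ofFun _ hlf, ⟨_, e, he, fun q hq => ?_, fun q => ?_, rfl⟩, fun q => ?_⟩
  · rw [coeff_ofFun]
    split_ifs with h
    · rfl
    · by_contra hne
      exact absurd (hgap q hne (not_le.1 h)) (not_le.2 hq)
  · rw [coeff_ofFun]
    split_ifs
    · exact le_rfl
    · exact h0 q
  · rw [coeff_add, coeff_one, coeff_ofFun, abs_of_nonneg (h0 q)]
    rcases lt_trichotomy q 0 with h | h | h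
    · rw [hb q h, if_neg h.ne, if_pos h.le, add_zero]
    · subst h; simpa using h1
    · rw [if_neg h.ne', if_neg (not_le.2 h), zero_add]

theorem NearOne.one_dom {Z : LeviCivita} (hZ : NearOne Z) : Dom 1 Z := by
  obtain ⟨θ, e, -, -, h0, rfl⟩ := hZ
  intro q
  rw [coeff_add, coeff_one]
  have hθq := h0 q
  split_ifs <;> simp [hθq]

theorem NearOne.suppGE {Z : LeviCivita} (hZ : NearOne Z) : SuppGE 0 Z := by
  obtain ⟨θ, e, he, hθ, -, rfl⟩ := hZ
  exact suppGE_one.add (hθ.mono he.le)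

theorem exists_nearOne_of_abs_le {z : LeviCivita} (hz : |z| ≤ 1) : ∃ Z, NearOne Z ∧ Dom z Z := by
  rw [← ofReal_one] at hz
  obtain ⟨Z, hZ, h⟩ := exists_nearOne_dom (suppGE_of_abs_le_ofReal hz).absC
    (fun q => abs_nonneg _) (abs_coeff_le_of_abs_le hz)
  exact ⟨Z, hZ, (dom_absC z).trans h⟩

/-! ### Power series that converge weakly on `(0,1)` are rapidly decreasing -/

theorem hasFPowerSeriesOnBall_ofScalars {c : ℕ → ℝ} {R : NNReal} (hR : 0 < R) {C : ℝ}
    (hC : ∀ n, |c n| * (R : ℝ) ^ n ≤ C) :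
    HasFPowerSeriesOnBall (FormalMultilinearSeries.ofScalars ℝ c).sum
      (FormalMultilinearSeries.ofScalars ℝ c) 0 R := by
  have hRpos : (0 : ENNReal) < R := by exact_mod_cast hR
  have hradius : (R : ENNReal) ≤ (FormalMultilinearSeries.ofScalars ℝ c).radius :=
    FormalMultilinearSeries.le_radius_of_bound _ C fun n => by
      simpa [FormalMultilinearSeries.ofScalars_norm] using hC n
  exact (FormalMultilinearSeries.hasFPowerSeriesOnBall _ (hRpos.trans_le hradius)).mono
    hRpos hradius

theorem eq_zero_of_tendsto_zero_of_infinite {c : ℕ → ℝ} {R : NNReal} (hR : 0 < R) {C : ℝ}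
    (hC : ∀ n, |c n| * (R : ℝ) ^ n ≤ C) {W K : Set ℝ} (hW : W.Infinite) (hWK : W ⊆ K)
    (hK : IsCompact K) (hKR : K ⊆ Metric.ball 0 R)
    (h : ∀ r ∈ W, Tendsto (fun N => ∑ n ∈ Finset.range N, c n * r ^ n) atTop (𝓝 0)) (n : ℕ) :
    c n = 0 := by
  set p := FormalMultilinearSeries.ofScalars ℝ c with hp
  have hball := hasFPowerSeriesOnBall_ofScalars hR hC
  have hanalytic : AnalyticOnNhd ℝ p.sum (Metric.ball 0 R) := by
    simpa only [Metric.eball_coe] using hball.analyticOnNhd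
  have hzero : ∀ r ∈ W, p.sum r = 0 := fun r hr => by
    have hr' : r ∈ Metric.eball (0 : ℝ) R := by simpa only [Metric.eball_coe] using hKR (hWK hr)
    have hsum : HasSum (fun n => c n * r ^ n) (p.sum r) := by
      simpa [hp, mul_comm] using hball.hasSum hr'
    exact tendsto_nhds_unique hsum.tendsto_sum_nat (h r hr)
  obtain ⟨x, hx, hacc⟩ := hW.exists_accPt_of_subset_isCompact hK hWK
  have heq : Set.EqOn p.sum 0 (Metric.ball 0 R) :=
    hanalytic.eqOn_zero_of_preconnected_of_frequently_eq_zero (convex_ball 0 _).isPreconnected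
      (hKR hx) ((accPt_iff_frequently_nhdsNE.1 hacc).mono hzero)
  have hp0 : HasFPowerSeriesAt (0 : ℝ → ℝ) p 0 :=
    hball.hasFPowerSeriesAt.congr (heq.eventuallyEq_of_mem (Metric.ball_mem_nhds 0 hR))
  exact congrFun ((FormalMultilinearSeries.ofScalars_series_eq_zero ℝ).1 hp0.eq_zero) n

theorem exists_infinite_of_not_countable {α : Type*} {U : Set α} (hU : ¬U.Countable)
    {P : ℕ → α → Prop} (hP : ∀ x ∈ U, ∃ n, P n x) : ∃ n, {x ∈ U | P n x}.Infinite := by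
  by_contra! hfin
  refine hU ((Set.countable_iUnion fun n => (hfin n).countable).mono fun x hx => ?_)
  obtain ⟨n, hn⟩ := hP x hx
  exact Set.mem_iUnion.2 ⟨n, hx, hn⟩

theorem exists_coeff_eq_zero_of_infinite (x : LeviCivita) {q₀ : ℚ} {E : Set ℚ} (hE : E.Infinite)
    (hle : ∀ q ∈ E, q ≤ q₀) : ∃ q ∈ E, coeff x q = 0 := by
  by_contra! hne
  exact hE ((leftFinite_supp x q₀).subset fun q hq => ⟨hne q hq, hle q hq⟩)

theorem coeff_mul_ofReal_pow (x : LeviCivita) (r : ℝ) (n : ℕ) (q : ℚ) :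
    coeff (x * ofReal r ^ n) q = coeff x q * r ^ n := by
  rw [← ofReal_pow, mul_comm, coeff_ofReal_mul, mul_comm]

/-- The power series with coefficients `v` converges weakly on `(0,1)`. -/
def ConvUnit (v : ℕ → LeviCivita) : Prop :=
  ∀ z : LeviCivita, 0 < z → z < 1 →
    ∃ l, WeakTendsto (fun N => ∑ n ∈ Finset.range N, v n * z ^ n) l

theorem ConvUnit.exists_tendsto_coeff {v : ℕ → LeviCivita} (hv : ConvUnit v) {r : ℝ}
    (h0 : 0 < r) (h1 : r < 1) : ∃ l : LeviCivita, ∀ q,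
      Tendsto (fun N => ∑ n ∈ Finset.range N, coeff (v n) q * r ^ n) atTop (𝓝 (coeff l q)) := by
  obtain ⟨l, hl⟩ := hv (ofReal r) (ofReal_zero ▸ ofReal_lt h0) (ofReal_one ▸ ofReal_lt h1)
  refine ⟨l, fun q => ?_⟩
  simpa only [coeff_sum, coeff_mul_ofReal_pow] using hl.tendsto_coeff q

theorem ConvUnit.regular {v : ℕ → LeviCivita} (hv : ConvUnit v) : Regular v := by
  refine ⟨{q | ∃ n, coeff (v n) q ≠ 0}, fun q₀ => ?_, fun n q hq => ⟨n, hq⟩⟩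
  by_contra hinf
  choose! l hl using fun r h0 h1 => hv.exists_tendsto_coeff (r := r) h0 h1
  have hmem : ∀ r ∈ Set.Icc (1 / 4 : ℝ) (1 / 2), 0 < r ∧ r < 1 := fun r hr =>
    ⟨by linarith [hr.1], by linarith [hr.2]⟩
  let e := Set.Infinite.natEmbedding _ hinf
  -- Each sum `l r` misses one of the infinitely many exponents `e j`, and there are uncountably
  -- many `r`, so the real power series at some exponent `e J` has infinitely many zeros.
  obtain ⟨J, hJ⟩ : ∃ J, {r ∈ Set.Icc (1 / 4 : ℝ) (1 / 2) | coeff (l r) (e J) = 0}.Infinite := by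
    refine exists_infinite_of_not_countable ?_ fun r _ => ?_
    · rw [← Cardinal.le_aleph0_iff_set_countable, Cardinal.mk_Icc_real (by norm_num), not_le]
      exact Cardinal.aleph0_lt_continuum
    · obtain ⟨_, ⟨j, rfl⟩, hj⟩ := exists_coeff_eq_zero_of_infinite (l r) (q₀ := q₀)
        (E := Set.range fun j => (e j : ℚ))
        (Set.infinite_range_of_injective (Subtype.val_injective.comp e.injective))
        (by rintro _ ⟨j, rfl⟩; exact (e j).2.2)
      exact ⟨j, hj⟩
  obtain ⟨n, hn⟩ := (e J).2.1
  obtain ⟨C, hC⟩ := (tendsto_zero_of_tendsto_sum_range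
    (hl (3 / 4) (by norm_num) (by norm_num) (e J))).norm.bddAbove_range
  refine hn (eq_zero_of_tendsto_zero_of_infinite (c := fun n => coeff (v n) (e J)) (R := 3 / 4)
    (C := C) (by norm_num) (fun n => ?_) hJ (fun r hr => hr.1) isCompact_Icc (fun r hr => ?_)
    (fun r hr => ?_) n)
  · simpa [abs_mul] using hC ⟨n, rfl⟩
  · rw [Metric.mem_ball, dist_zero_right, Real.norm_eq_abs, abs_of_pos (hmem r hr).1]
    norm_num
    linarith [hr.2]
  · simpa only [hr.2] using hl r (hmem r hr.1).1 (hmem r hr.1).2 (e J)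

open Matrix in
theorem tendsto_zero_of_tendsto_sum_pow_mul {ι : Type*} {l : Filter ι} {K : ℕ} {α : ℕ → ι → ℝ}
    (h : ∀ c : ℝ, 0 < c → Tendsto (fun i => ∑ m ∈ Finset.range K, c ^ m * α m i) l (𝓝 0))
    {m : ℕ} (hm : m < K) : Tendsto (α m) l (𝓝 0) := by
  let V : Matrix (Fin K) (Fin K) ℝ := vandermonde fun j => (j : ℝ) + 1
  have hV : IsUnit V.det := isUnit_iff_ne_zero.2 <| det_vandermonde_ne_zero_iff.2 fun i j hij =>
    Fin.ext (by exact_mod_cast add_right_cancel hij)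
  have hVα : Tendsto (fun i => V *ᵥ fun k => α k i) l (𝓝 0) := by
    refine tendsto_pi_nhds.2 fun j => (h (j + 1) (by positivity)).congr fun i => ?_
    exact (Fin.sum_univ_eq_sum_range (fun k => ((j : ℝ) + 1) ^ k * α k i) K).symm
  have hα := ((Continuous.matrix_mulVec continuous_const continuous_id).tendsto
    (0 : Fin K → ℝ) : Tendsto (fun x => V⁻¹ *ᵥ x) _ _).comp hVα
  simp only [Function.comp_def, id, mulVec_mulVec, nonsing_inv_mul V hV, one_mulVec,
    mulVec_zero] at hα
  exact tendsto_pi_nhds.1 hα ⟨m, hm⟩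

theorem monomial_pow (q : ℚ) (r : ℝ) (m : ℕ) : monomial q r ^ m = monomial (m * q) (r ^ m) := by
  induction m with
  | zero => simp only [pow_zero, Nat.cast_zero, zero_mul]; rfl
  | succ m ih => rw [pow_succ, ih, monomial_mul, pow_succ]; congr 1; push_cast; ring

theorem Regular.exists_suppGE {ι : Type*} {w : ι → LeviCivita} (hw : Regular w) :
    ∃ a, ∀ i, SuppGE a (w i) := by
  obtain ⟨S, hS, hwS⟩ := hw
  obtain ⟨a, ha⟩ := hS.exists_le
  exact ⟨a, fun i q hq => (hwS i).eq_zero fun hqS => absurd (ha q hqS) (not_le.2 hq)⟩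

theorem ConvUnit.tendsto_choose_mul {v : ℕ → LeviCivita} (hv : ConvUnit v) (q : ℚ) (k : ℕ) :
    Tendsto (fun n => (n.choose k : ℝ) * coeff (v n) q) atTop (𝓝 0) := by
  obtain ⟨a, ha⟩ := hv.regular.exists_suppGE
  obtain ⟨K, hK⟩ := exists_nat_gt (q + k - a)
  -- Convergence at `1 - c d`, where `d` is infinitesimal, is tested at the exponent `q + k`.
  have hterms : ∀ c : ℝ, 0 < c → Tendsto (fun n => ∑ m ∈ Finset.range (K + k + 1),
      c ^ m * ((-1) ^ m * ((n.choose m : ℝ) * coeff (v n) (q + k - m)))) atTop (𝓝 0) := by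
    intro c hc
    have hlt : monomial 1 c < 1 :=
      lt_of_abs_lt ((suppGE_monomial 1 c).abs_lt_monomial (m' := 0) (by norm_num) one_pos)
    obtain ⟨l, hl⟩ := hv (1 - monomial 1 c) (sub_pos.2 hlt) (sub_lt_self 1 (monomial_pos 1 hc))
    have hcoeff := hl.tendsto_coeff (q + k)
    simp only [coeff_sum] at hcoeff
    refine (tendsto_zero_of_tendsto_sum_range hcoeff).congr fun n => ?_
    rw [sub_eq_add_neg, ← monomial_neg, coeff_mul_one_add_pow (ha n) (suppGE_monomial 1 (-c))
      zero_le_one (K := K + k + 1) (by push_cast; linarith [k.cast_nonneg (α := ℚ)])]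
    refine Finset.sum_congr rfl fun m _ => ?_
    rw [mul_comm (v n), monomial_pow, coeff_monomial_mul, mul_one, neg_pow]
    ring
  have hk := (tendsto_zero_of_tendsto_sum_pow_mul hterms (by omega : k < _)).const_mul ((-1) ^ k)
  rw [mul_zero] at hk
  refine hk.congr fun n => ?_
  rw [add_sub_cancel_right, ← mul_assoc, ← mul_pow]
  simp

theorem add_one_pow_le_choose {n j : ℕ} (h : 2 * j ≤ n + 1) :
    ((n : ℝ) + 1) ^ j ≤ 2 ^ j * j.factorial * n.choose j := by
  have hnat : (n + 1) ^ j ≤ 2 ^ j * (j.factorial * n.choose j) := by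
    rw [← Nat.descFactorial_eq_factorial_mul_choose]
    calc (n + 1) ^ j ≤ (2 * (n + 1 - j)) ^ j := Nat.pow_le_pow_left (by omega) j
      _ = 2 ^ j * (n + 1 - j) ^ j := mul_pow _ _ _
      _ ≤ _ := Nat.mul_le_mul_left _ (Nat.pow_sub_le_descFactorial n j)
  rw [mul_assoc]
  exact_mod_cast hnat

theorem ConvUnit.rapid {v : ℕ → LeviCivita} (hv : ConvUnit v) : Rapid v := by
  refine ⟨hv.regular, fun q k => ?_⟩
  have hsum : Summable fun n : ℕ =>
      (2 ^ (k + 2) * (k + 2).factorial : ℝ) * (1 / ((n : ℝ) + 1) ^ 2) := by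
    refine Summable.mul_left _ ?_
    simpa using (summable_nat_add_iff 1).2 (Real.summable_one_div_nat_pow.2 one_lt_two)
  refine Summable.of_norm_bounded_eventually_nat hsum ?_
  filter_upwards [Metric.tendsto_nhds.1 (hv.tendsto_choose_mul q (k + 2)) 1 one_pos,
    eventually_ge_atTop (2 * (k + 2))] with n hn hk
  rw [Real.dist_eq, sub_zero, abs_mul, Nat.abs_cast] at hn
  rw [Real.norm_of_nonneg (by positivity), mul_one_div, le_div_iff₀ (by positivity)]
  calc ((n : ℝ) + 1) ^ k * |coeff (v n) q| * ((n : ℝ) + 1) ^ 2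
      = ((n : ℝ) + 1) ^ (k + 2) * |coeff (v n) q| := by rw [pow_add]; ring
    _ ≤ 2 ^ (k + 2) * (k + 2).factorial * n.choose (k + 2) * |coeff (v n) q| := by
        gcongr
        exact add_one_pow_le_choose (by omega)
    _ = 2 ^ (k + 2) * (k + 2).factorial * (n.choose (k + 2) * |coeff (v n) q|) := by ring
    _ ≤ 2 ^ (k + 2) * (k + 2).factorial * 1 := by gcongr
    _ = _ := mul_one _

/-! ### Sums of rapidly decreasing power series -/

theorem hasWSum_of_finite {w : ℕ → LeviCivita} {N : ℕ} (h : ∀ n, N ≤ n → w n = 0) :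
    HasWSum w (∑ n ∈ Finset.range N, w n) := by
  refine ⟨⟨⋃ n ∈ Finset.range N, {q | coeff (w n) q ≠ 0}, ?_, fun n q hq => ?_⟩, fun q => ?_⟩
  · intro r
    refine ((Finset.range N).finite_toSet.biUnion fun m _ => leftFinite_supp (w m) r).subset ?_
    rintro q ⟨hq, hqr⟩
    obtain ⟨m, hm, hq⟩ := Set.mem_iUnion₂.1 hq
    exact Set.mem_biUnion (Finset.mem_coe.2 hm) ⟨hq, hqr⟩
  · refine Set.mem_iUnion₂.2 ⟨n, ?_, hq⟩
    rw [Finset.mem_range]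
    by_contra hn
    rw [h n (not_lt.1 hn)] at hq
    exact hq rfl
  · rw [coeff_sum]
    refine hasSum_sum_of_ne_finset_zero fun n hn => ?_
    rw [h n (not_lt.1 fun h' => hn (Finset.mem_range.2 h'))]
    rfl

theorem Dom.natCast_mul {x b : LeviCivita} (h : Dom x b) {m n : ℕ} (hmn : m ≤ n) :
    Dom (m * x) (n * b) := fun q => by
  rw [coeff_natCast_mul, coeff_natCast_mul, abs_mul, Nat.abs_cast]
  exact mul_le_mul (Nat.cast_le.2 hmn) (h q) (abs_nonneg _) (Nat.cast_nonneg _)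

theorem NearOne.dom_pow_pow {Z : LeviCivita} (hZ : NearOne Z) {m n : ℕ} (h : m ≤ n) :
    Dom (Z ^ m) (Z ^ n) := by
  obtain ⟨k, rfl⟩ := Nat.exists_eq_add_of_le h
  have := (hZ.one_dom.refl_right.pow m).mul (hZ.one_dom.pow k)
  rwa [one_pow, mul_one, ← pow_add] at this

theorem Rapid.mul_pow {v : ℕ → LeviCivita} (hv : Rapid v) {z Z : LeviCivita} (hZ : NearOne Z)
    (hz : Dom z Z) : Rapid fun n => v n * z ^ n :=
  (hv.absC.mul_polyGrowth hZ.polyGrowth).of_dom fun n => (dom_absC _).mul (hz.pow n)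

theorem Rapid.exists_hasWSum_pow {v : ℕ → LeviCivita} (hv : Rapid v) {z : LeviCivita}
    (hz : |z| ≤ 1) : ∃ s, HasWSum (fun n => v n * z ^ n) s := by
  obtain ⟨Z, hZ, hzZ⟩ := exists_nearOne_of_abs_le hz
  exact (hv.mul_pow hZ hzZ).exists_hasWSum

theorem Rapid.exists_hasWSum_choose_mul_pow {v : ℕ → LeviCivita} (hv : Rapid v) {z : LeviCivita}
    (hz : |z| ≤ 1) (k : ℕ) : ∃ s, HasWSum (fun n => v n * (n.choose k * z ^ (n - k))) s := by
  obtain ⟨Z, hZ, hzZ⟩ := exists_nearOne_of_abs_le hz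
  refine ((hv.absC.mul_polyGrowth (hZ.polyGrowth.mul_natCast_pow k)).of_dom
    fun n => (dom_absC (v n)).mul ?_).exists_hasWSum
  exact ((hzZ.pow (n - k)).trans (hZ.dom_pow_pow (n.sub_le k))).natCast_mul
    ((Nat.choose_le_pow n k).trans (Nat.pow_le_pow_left n.le_succ k))

theorem Rapid.exists_hasWSum_deriv {v : ℕ → LeviCivita} (hv : Rapid v) {z : LeviCivita}
    (hz : |z| ≤ 1) : ∃ d, HasWSum (fun n => v n * (n * z ^ (n - 1))) d := by
  simpa only [Nat.choose_one_right] using hv.exists_hasWSum_choose_mul_pow hz 1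

theorem exists_pow_taylor {z z' Z : LeviCivita} (hZ : NearOne Z) (hz : Dom z Z)
    (hz' : Dom z' Z) (n : ℕ) : ∃ Q : LeviCivita,
      z' ^ n = z ^ n + n * z ^ (n - 1) * (z' - z) + Q * (z' - z) ^ 2 ∧
      Dom Q (((n + 1) ^ 2 : ℕ) * Z ^ n) := by
  induction n with
  | zero =>
    refine ⟨0, by simp, fun q => ?_⟩
    rw [coeff_zero, abs_zero, coeff_natCast_mul]
    exact mul_nonneg (Nat.cast_nonneg _) (hZ.one_dom.refl_right.pow 0 |>.nonneg q)
  | succ n ih =>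
    obtain ⟨Q, hQ, hQd⟩ := ih
    refine ⟨Q * z' + n * z ^ (n - 1), ?_, ?_⟩
    · have hn : (n : LeviCivita) * z ^ (n - 1) * z = n * z ^ n := by
        rcases n with _ | n
        · simp
        · rw [Nat.add_sub_cancel, mul_assoc, ← pow_succ]
      rw [Nat.add_sub_cancel, pow_succ, pow_succ z]
      push_cast
      linear_combination z' * hQ + (z' - z) * hn
    · have hQz' : Dom (Q * z') (((n + 1) ^ 2 : ℕ) * Z ^ (n + 1)) := by
        simpa only [mul_assoc, ← pow_succ] using hQd.mul hz'
      have hnz : Dom (n * z ^ (n - 1)) (n * Z ^ (n + 1)) :=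
        ((hz.pow (n - 1)).trans (hZ.dom_pow_pow (by omega))).natCast_mul le_rfl
      refine (hQz'.add hnz).trans ?_
      rw [← add_mul, ← Nat.cast_add]
      exact (hZ.dom_pow_pow le_rfl).natCast_mul (by ring_nf; omega)

theorem exists_nearOne_of_abs_le_of_abs_le {z z' : LeviCivita} (hz : |z| ≤ 1) (hz' : |z'| ≤ 1) :
    ∃ Z, NearOne Z ∧ Dom z Z ∧ Dom z' Z := by
  obtain ⟨_, ⟨θ, e, he, hθ, h0, rfl⟩, h⟩ := exists_nearOne_of_abs_le hz
  obtain ⟨_, ⟨θ', e', he', hθ', h0', rfl⟩, h'⟩ := exists_nearOne_of_abs_le hz'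
  refine ⟨1 + (θ + θ'), ⟨θ + θ', min e e', lt_min he he', (hθ.mono (min_le_left _ _)).add
    (hθ'.mono (min_le_right _ _)), fun q => add_nonneg (h0 q) (h0' q), rfl⟩,
    fun q => (h q).trans ?_, fun q => (h' q).trans ?_⟩
  · simp only [coeff_add]
    linarith [h0' q]
  · simp only [coeff_add]
    linarith [h0 q]

theorem Rapid.exists_taylor {v : ℕ → LeviCivita} (hv : Rapid v) {m : ℚ}
    (hm : ∀ n, SuppGE m (v n)) {z z' s s' d : LeviCivita} (hz : |z| ≤ 1) (hz' : |z'| ≤ 1)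
    (hs : HasWSum (fun n => v n * z ^ n) s) (hs' : HasWSum (fun n => v n * z' ^ n) s')
    (hd : HasWSum (fun n => v n * (n * z ^ (n - 1))) d) :
    ∃ K, SuppGE m K ∧ s' = s + d * (z' - z) + K * (z' - z) ^ 2 := by
  obtain ⟨Z, hZ, hzZ, hz'Z⟩ := exists_nearOne_of_abs_le_of_abs_le hz hz'
  choose Q hQ hQd using exists_pow_taylor hZ hzZ hz'Z
  obtain ⟨K, hK⟩ := ((hv.absC.mul_polyGrowth (hZ.polyGrowth.mul_natCast_pow 2)).of_dom
    fun n => (dom_absC (v n)).mul (hQd n)).exists_hasWSum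
  refine ⟨K, hK.suppGE fun n => ?_, hs'.unique ?_⟩
  · have hQ0 : SuppGE 0 (Q n) := (hQd n).suppGE fun q hq => by
      rw [coeff_natCast_mul, hZ.suppGE.pow_zero n q hq, mul_zero]
    simpa only [add_zero] using (hm n).mul hQ0
  · have h := (hs.add (hd.mul_left (z' - z))).add (hK.mul_left ((z' - z) ^ 2))
    rw [mul_comm d, mul_comm K]
    convert h using 2 with n
    rw [hQ n]
    ring

theorem hasWSum_binomial (V a c : LeviCivita) (n : ℕ) :
    HasWSum (fun k => V * ((n.choose k : LeviCivita) * (a ^ (n - k) * c ^ k)))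
      (V * (a + c) ^ n) := by
  have h : V * (a + c) ^ n = ∑ k ∈ Finset.range (n + 1),
      V * ((n.choose k : LeviCivita) * (a ^ (n - k) * c ^ k)) := by
    rw [add_comm a c, add_pow, Finset.mul_sum]
    exact Finset.sum_congr rfl fun k _ => by ring
  rw [h]
  refine hasWSum_of_finite fun k hk => ?_
  rw [Nat.choose_eq_zero_of_lt (by omega), Nat.cast_zero, zero_mul, mul_zero]

theorem exists_nearOne_dom_absC_add {z y : LeviCivita} (h : |z| + |y| ≤ 1) :
    ∃ Z, NearOne Z ∧ Dom (absC z + absC y) Z := by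
  have hz : |z| ≤ ofReal 1 := by rw [ofReal_one]; linarith [abs_nonneg y]
  have hy : |y| ≤ ofReal 1 := by rw [ofReal_one]; linarith [abs_nonneg z]
  have hadd : |coeff (z + y) 0| ≤ 1 :=
    abs_coeff_le_of_abs_le ((abs_add_le _ _).trans (h.trans_eq ofReal_one.symm))
  have hsub : |coeff (z - y) 0| ≤ 1 :=
    abs_coeff_le_of_abs_le ((abs_sub _ _).trans (h.trans_eq ofReal_one.symm))
  refine exists_nearOne_dom ((suppGE_of_abs_le_ofReal hz).absC.add
    (suppGE_of_abs_le_ofReal hy).absC) (fun q => ?_) ?_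
  · rw [coeff_add, coeff_absC, coeff_absC]
    positivity
  · rw [coeff_add, abs_le] at hadd
    rw [coeff_sub, abs_le] at hsub
    rw [coeff_add, coeff_absC, coeff_absC]
    rcases abs_cases (coeff z 0) with hz0 | hz0 <;> rcases abs_cases (coeff y 0) with hy0 | hy0 <;>
      linarith [hadd.1, hadd.2, hsub.1, hsub.2]

theorem Rapid.exists_hasWSum_binomial_of_nonneg {v : ℕ → LeviCivita} (hv : Rapid v)
    {a c : LeviCivita}
    (h0 : ∀ n k q, 0 ≤ coeff (v n * ((n.choose k : LeviCivita) * (a ^ (n - k) * c ^ k))) q)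
    {Z : LeviCivita} (hZ : NearOne Z) (hac : Dom (a + c) Z) :
    ∃ B, HasWSum (fun p : ℕ × ℕ =>
      v p.1 * ((p.1.choose p.2 : LeviCivita) * (a ^ (p.1 - p.2) * c ^ p.2))) B := by
  have hrapid := hv.mul_pow hZ hac
  have hrow := fun n => hasWSum_binomial (v n) a c n
  obtain ⟨S, hS, hvS⟩ := hrapid.regular
  have hterm : ∀ n k, HasSupp S (v n * ((n.choose k : LeviCivita) * (a ^ (n - k) * c ^ k))) :=
    fun n k => Dom.hasSupp (fun q => (abs_of_nonneg (h0 n k q)).trans_le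
      (le_hasSum ((hrow n).hasSum q) k fun j _ => h0 n j q)) (hvS n)
  refine LC.exists_hasWSum hS (fun p => hterm p.1 p.2) fun q => ?_
  rw [summable_prod_of_nonneg fun p => h0 p.1 p.2 q]
  refine ⟨fun n => ((hrow n).hasSum q).summable, ?_⟩
  have hsum := hrapid.summable q 0
  simp only [pow_zero, one_mul] at hsum
  exact hsum.of_abs.congr fun n => ((hrow n).hasSum q).tsum_eq.symm

theorem Rapid.exists_hasWSum_binomial {v : ℕ → LeviCivita} (hv : Rapid v) {z y : LeviCivita}
    (h : |z| + |y| ≤ 1) : ∃ s, HasWSum (fun p : ℕ × ℕ =>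
      v p.1 * ((p.1.choose p.2 : LeviCivita) * (z ^ (p.1 - p.2) * y ^ p.2))) s := by
  obtain ⟨Z, hZ, hdomZ⟩ := exists_nearOne_dom_absC_add h
  have hdom : ∀ n k : ℕ, Dom (v n * (n.choose k * (z ^ (n - k) * y ^ k)))
      (LC.absC (v n) * (n.choose k * (LC.absC z ^ (n - k) * LC.absC y ^ k))) := fun n k =>
    (dom_absC _).mul ((((dom_absC z).pow _).mul ((dom_absC y).pow _)).natCast_mul le_rfl)
  obtain ⟨B, hB⟩ := hv.absC.exists_hasWSum_binomial_of_nonneg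
    (fun n k => (hdom n k).nonneg) hZ hdomZ
  obtain ⟨s, hs, -⟩ := hB.of_dom fun p => hdom p.1 p.2
  exact ⟨s, hs⟩

theorem Rapid.hasWSum_recenter {v β : ℕ → LeviCivita} (hv : Rapid v) {z y s : LeviCivita}
    (h : |z| + |y| ≤ 1) (hs : HasWSum (fun n => v n * (z + y) ^ n) s)
    (hβ : ∀ k, HasWSum (fun n => v n * (n.choose k * z ^ (n - k))) (β k)) :
    HasWSum (fun k => β k * y ^ k) s := by
  obtain ⟨s', hs'⟩ := hv.exists_hasWSum_binomial h
  rw [hs.unique (hs'.prod_fiberwise fun n => hasWSum_binomial (v n) z y n)]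
  refine hs'.swap.prod_fiberwise fun k => ?_
  rw [mul_comm (β k)]
  convert (hβ k).mul_left (y ^ k) using 2 with n
  simp only [Prod.swap_prod_mk]
  ring

/-! ### Simple functions -/

/-- `f` is represented on `D` by a rapidly decreasing power series in the normalized variable
`(x - x₀) / H`, where `D` lies within distance `|H|` of `x₀`. -/
structure Rep (f : LeviCivita → LeviCivita) (D : Set LeviCivita) (x₀ H : LeviCivita)
    (v : ℕ → LeviCivita) : Prop where
  ne_zero : H ≠ 0
  rapid : Rapid v
  dist_le : ∀ x ∈ D, |x - x₀| ≤ |H|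
  hasWSum : ∀ x ∈ D, HasWSum (fun n => v n * ((x - x₀) / H) ^ n) (f x)

theorem abs_div_le_one {x H : LeviCivita} (hH : H ≠ 0) (h : |x| ≤ |H|) : |x / H| ≤ 1 := by
  rw [abs_div, div_le_one (abs_pos.2 hH)]
  exact h

theorem Rep.of_weakTendsto {f : LeviCivita → LeviCivita} {D : Set LeviCivita}
    {x₀ H : LeviCivita} {a : ℕ → LeviCivita} (hH : H ≠ 0) (hdist : ∀ x ∈ D, |x - x₀| ≤ |H|)
    (hD : ∀ z, 0 < z → z < 1 → x₀ + H * z ∈ D)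
    (ha : ∀ x ∈ D,
      WeakTendsto (fun N => ∑ n ∈ Finset.range N, a n * (x - x₀) ^ n) (f x)) :
    Rep f D x₀ H fun n => a n * H ^ n := by
  have hunit : ConvUnit fun n => a n * H ^ n := fun z h0 h1 => by
    refine ⟨f (x₀ + H * z), ?_⟩
    simpa only [add_sub_cancel_left, mul_pow, mul_assoc] using ha _ (hD z h0 h1)
  refine ⟨hH, hunit.rapid, hdist, fun x hx => ?_⟩
  obtain ⟨s, hs⟩ := hunit.rapid.exists_hasWSum_pow (abs_div_le_one hH (hdist x hx))
  have hsum : ∀ n, a n * H ^ n * ((x - x₀) / H) ^ n = a n * (x - x₀) ^ n := fun n => by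
    rw [div_pow, mul_assoc, mul_div_cancel₀ _ (pow_ne_zero n hH)]
  have hs' := hs.weakTendsto
  simp only [hsum] at hs'
  rwa [hs'.unique (ha x hx)] at hs

theorem IsSimpleOn.exists_rep {f : LeviCivita → LeviCivita} {I : Interval} (h : IsSimpleOn f I)
    (hI : I.left < I.right) :
    ∃ x₀ ∈ Set.Icc I.left I.right, ∃ H v,
      (∀ x ∈ Set.Icc I.left I.right, |x - x₀| ≤ |H|) ∧ Rep f I.carrier x₀ H v := by
  obtain ⟨x₀, hx₀, a, ha⟩ := h
  obtain ⟨H, hH, hdist, hIoo⟩ : ∃ H : LeviCivita, H ≠ 0 ∧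
      (∀ x ∈ Set.Icc I.left I.right, |x - x₀| ≤ |H|) ∧
      ∀ z, 0 < z → z < 1 → x₀ + H * z ∈ Set.Ioo I.left I.right := by
    rcases le_total (x₀ - I.left) (I.right - x₀) with hle | hle
    · have hpos : 0 < I.right - x₀ := by linarith
      refine ⟨I.right - x₀, hpos.ne', fun x hx => ?_, fun z h0 h1 => ?_⟩
      · rw [abs_of_pos hpos]
        exact abs_le.2 ⟨by linarith [hx.1], by linarith [hx.2]⟩
      · constructor <;> nlinarith [hx₀.1, hx₀.2]
    · have hpos : 0 < x₀ - I.left := by linarith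
      refine ⟨I.left - x₀, by linarith, fun x hx => ?_, fun z h0 h1 => ?_⟩
      · rw [abs_sub_comm I.left, abs_of_pos hpos]
        exact abs_le.2 ⟨by linarith [hx.1], by linarith [hx.2]⟩
      · constructor <;> nlinarith [hx₀.1, hx₀.2]
  exact ⟨x₀, hx₀, H, _, hdist, .of_weakTendsto hH (fun x hx => hdist x (I.subset_Icc hx))
    (fun z h0 h1 => I.Ioo_subset (hIoo z h0 h1)) ha⟩

theorem Rep.weakTendsto {f : LeviCivita → LeviCivita} {D : Set LeviCivita} {x₀ H : LeviCivita}
    {v : ℕ → LeviCivita} (h : Rep f D x₀ H v) {x : LeviCivita} (hx : x ∈ D) :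
    WeakTendsto (fun N => ∑ n ∈ Finset.range N, v n / H ^ n * (x - x₀) ^ n) (f x) := by
  simpa only [div_pow, mul_div_assoc', div_mul_eq_mul_div] using (h.hasWSum x hx).weakTendsto

theorem Rep.isSimpleOn {f : LeviCivita → LeviCivita} {I : Interval} {x₀ H : LeviCivita}
    {v : ℕ → LeviCivita} (h : Rep f I.carrier x₀ H v) (hx₀ : x₀ ∈ Set.Icc I.left I.right) :
    IsSimpleOn f I :=
  ⟨x₀, hx₀, fun n => v n / H ^ n, fun _ hx => h.weakTendsto hx⟩

theorem Rep.recenter {f : LeviCivita → LeviCivita} {D : Set LeviCivita} {x₀ H : LeviCivita}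
    {v : ℕ → LeviCivita} (h : Rep f D x₀ H v) {x₁ : LeviCivita} (hx₁ : |x₁ - x₀| ≤ |H|)
    {E : Set LeviCivita} (hE : E ⊆ D) (hle : ∀ x ∈ E, |x₁ - x₀| + |x - x₁| ≤ |H|) :
    ∃ b : ℕ → LeviCivita, ∀ x ∈ E,
      WeakTendsto (fun N => ∑ n ∈ Finset.range N, b n * (x - x₁) ^ n) (f x) := by
  choose β hβ using h.rapid.exists_hasWSum_choose_mul_pow (abs_div_le_one h.ne_zero hx₁)
  refine ⟨fun k => β k / H ^ k, fun x hx => ?_⟩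
  have habs : |(x₁ - x₀) / H| + |(x - x₁) / H| ≤ 1 := by
    rw [abs_div, abs_div, ← add_div, div_le_one (abs_pos.2 h.ne_zero)]
    exact hle x hx
  have hsplit : (x₁ - x₀) / H + (x - x₁) / H = (x - x₀) / H := by ring
  have hs := h.rapid.hasWSum_recenter habs (hsplit ▸ h.hasWSum x (hE hx)) hβ
  simpa only [div_pow, mul_div_assoc', div_mul_eq_mul_div] using hs.weakTendsto

theorem Interval.Icc_subset_Icc {I J : Interval} (hJI : J.carrier ⊆ I.carrier)
    (hJ : J.left < J.right) : I.left ≤ J.left ∧ J.right ≤ I.right := by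
  constructor
  · by_contra! h
    obtain ⟨x, h1, h2⟩ := exists_between (lt_min h hJ)
    have hx := (I.subset_Icc (hJI (J.Ioo_subset ⟨h1, h2.trans_le (min_le_right _ _)⟩))).1
    exact absurd (h2.trans_le (min_le_left _ _)) (not_lt.2 hx)
  · by_contra! h
    obtain ⟨x, h1, h2⟩ := exists_between (max_lt h hJ)
    have hx := (I.subset_Icc (hJI (J.Ioo_subset ⟨(le_max_right _ _).trans_lt h1, h2⟩))).2
    exact absurd ((le_max_left _ _).trans_lt h1) (not_lt.2 hx)

/-- The midpoint of an interval: the centre of the expansions of simple functions, chosen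
since two functions that are simple on the same interval can be expanded about it together. -/
noncomputable def Interval.midpoint (I : Interval) : LeviCivita := (I.left + I.right) / 2

theorem Interval.midpoint_mem (I : Interval) : I.midpoint ∈ Set.Icc I.left I.right := by
  have h := I.left_le_right
  constructor <;> rw [Interval.midpoint] <;> linarith

theorem Interval.abs_sub_midpoint_le (I : Interval) {x : LeviCivita}
    (hx : x ∈ Set.Icc I.left I.right) : |x - I.midpoint| ≤ (I.right - I.left) / 2 := by
  rw [Interval.midpoint]
  exact abs_le.2 ⟨by linarith [hx.1], by linarith [hx.2]⟩

theorem IsSimpleOn.exists_midpoint_expansion {f : LeviCivita → LeviCivita} {I J : Interval}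
    (h : IsSimpleOn f I) (hJI : J.carrier ⊆ I.carrier) (hJ : J.left < J.right) :
    ∃ b : ℕ → LeviCivita, ∀ x ∈ J.carrier,
      WeakTendsto (fun N => ∑ n ∈ Finset.range N, b n * (x - J.midpoint) ^ n) (f x) := by
  obtain ⟨hl, hr⟩ := Interval.Icc_subset_Icc hJI hJ
  have hsub : Set.Icc J.left J.right ⊆ Set.Icc I.left I.right := Set.Icc_subset_Icc hl hr
  obtain ⟨x₀, -, H, v, hdist, hrep⟩ := h.exists_rep (hl.trans_lt (hJ.trans_le hr))
  refine hrep.recenter (hdist _ (hsub J.midpoint_mem)) hJI fun x hx => ?_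
  have hleft := (neg_abs_le _).trans' (neg_le_neg (hdist J.left (hsub (Set.left_mem_Icc.2 hJ.le))))
  have hright := (le_abs_self _).trans (hdist J.right (hsub (Set.right_mem_Icc.2 hJ.le)))
  have hx' := J.abs_sub_midpoint_le (J.subset_Icc hx)
  rw [Interval.midpoint] at hx' ⊢
  rcases abs_cases ((J.left + J.right) / 2 - x₀) with hm | hm <;> linarith [hm.1]

theorem IsSimpleOn.exists_rep_midpoint {f : LeviCivita → LeviCivita} {I : Interval}
    (h : IsSimpleOn f I) (hI : I.left < I.right) :
    ∃ v, Rep f I.carrier I.midpoint ((I.right - I.left) / 2) v := by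
  obtain ⟨b, hb⟩ := h.exists_midpoint_expansion subset_rfl hI
  have hpos : 0 < (I.right - I.left) / 2 := by linarith
  refine ⟨_, .of_weakTendsto hpos.ne' (fun x hx => ?_) (fun z h0 h1 => I.Ioo_subset ?_) hb⟩
  · rw [abs_of_pos hpos]
    exact I.abs_sub_midpoint_le (I.subset_Icc hx)
  · rw [Interval.midpoint]
    constructor <;> nlinarith

theorem isSimpleOn_of_left_eq_right (f : LeviCivita → LeviCivita) {I : Interval}
    (h : I.left = I.right) : IsSimpleOn f I := by
  refine ⟨I.left, ⟨le_rfl, h.le⟩, fun n => if n = 0 then f I.left else 0, fun x hx => ?_⟩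
  have hx' := I.subset_Icc hx
  rw [← h, Set.Icc_self, Set.mem_singleton_iff] at hx'
  have hsum := (hasWSum_of_finite (w := fun n => (if n = 0 then f I.left else 0) *
    (x - I.left) ^ n) (N := 1) (fun n hn => by rw [if_neg (by omega), zero_mul])).weakTendsto
  simpa [hx'] using hsum

theorem isSimpleOn_const (c : LeviCivita) (I : Interval) : IsSimpleOn (fun _ => c) I := by
  refine ⟨I.left, ⟨le_rfl, I.left_le_right⟩, fun n => if n = 0 then c else 0, fun x _ => ?_⟩
  have hsum := (hasWSum_of_finite (w := fun n => (if n = 0 then c else 0) *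
    (x - I.left) ^ n) (N := 1) (fun n hn => by rw [if_neg (by omega), zero_mul])).weakTendsto
  simpa using hsum

theorem IsSimpleOn.congr {f g : LeviCivita → LeviCivita} {I : Interval} (h : IsSimpleOn f I)
    (hfg : ∀ x ∈ I.carrier, f x = g x) : IsSimpleOn g I := by
  obtain ⟨x₀, hx₀, a, ha⟩ := h
  exact ⟨x₀, hx₀, a, fun x hx => hfg x hx ▸ ha x hx⟩

theorem IsSimpleOn.restrict {f : LeviCivita → LeviCivita} {I J : Interval}
    (h : IsSimpleOn f I) (hJI : J.carrier ⊆ I.carrier) : IsSimpleOn f J := by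
  rcases J.left_le_right.eq_or_lt with hJ | hJ
  · exact isSimpleOn_of_left_eq_right f hJ
  · obtain ⟨b, hb⟩ := h.exists_midpoint_expansion hJI hJ
    exact ⟨_, J.midpoint_mem, b, hb⟩

theorem IsSimpleOn.add {f g : LeviCivita → LeviCivita} {I : Interval}
    (hf : IsSimpleOn f I) (hg : IsSimpleOn g I) : IsSimpleOn (fun x => f x + g x) I := by
  rcases I.left_le_right.eq_or_lt with hI | hI
  · exact isSimpleOn_of_left_eq_right _ hI
  · obtain ⟨a, ha⟩ := hf.exists_midpoint_expansion subset_rfl hI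
    obtain ⟨b, hb⟩ := hg.exists_midpoint_expansion subset_rfl hI
    refine ⟨_, I.midpoint_mem, fun n => a n + b n, fun x hx => ?_⟩
    simpa only [add_mul, Finset.sum_add_distrib] using (ha x hx).add (hb x hx)

theorem IsSimpleOn.ofReal_mul {f : LeviCivita → LeviCivita} {I : Interval} {r : ℝ} (hr : |r| ≤ 1)
    (hf : IsSimpleOn f I) : IsSimpleOn (fun x => ofReal r * f x) I := by
  obtain ⟨x₀, hx₀, a, ha⟩ := hf
  refine ⟨x₀, hx₀, fun n => ofReal r * a n, fun x hx => ?_⟩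
  simpa only [mul_assoc, Finset.mul_sum] using (ha x hx).ofReal_mul hr

theorem IsSimpleOn.neg {f : LeviCivita → LeviCivita} {I : Interval}
    (hf : IsSimpleOn f I) : IsSimpleOn (fun x => -f x) I := by
  refine (hf.ofReal_mul (r := -1) (by simp)).congr fun x _ => ?_
  rw [ofReal_neg, ofReal_one, neg_one_mul]

theorem IsSimpleOn.sub {f g : LeviCivita → LeviCivita} {I : Interval}
    (hf : IsSimpleOn f I) (hg : IsSimpleOn g I) : IsSimpleOn (fun x => f x - g x) I :=
  (hf.add hg.neg).congr fun _ _ => (sub_eq_add_neg _ _).symm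

/-! ### Derivatives of simple functions -/

theorem Rep.exists_deriv {F : LeviCivita → LeviCivita} {D : Set LeviCivita}
    {x₀ H : LeviCivita} {v : ℕ → LeviCivita} (h : Rep F D x₀ H v) {x d : LeviCivita} (hx : x ∈ D)
    (hd : HasWSum (fun n => v n * (n * ((x - x₀) / H) ^ (n - 1))) d) {ε : LeviCivita}
    (hε : 0 < ε) : ∃ δ : LeviCivita, 0 < δ ∧
      ∀ y ∈ D, |y - x| < δ → |F y - F x - d / H * (y - x)| ≤ ε * |y - x| := by
  obtain ⟨m, hm⟩ := h.rapid.regular.exists_suppGE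
  have hM : (0 : LeviCivita) < monomial (m - 1) 1 := monomial_pos _ one_pos
  have hH2 : 0 < H ^ 2 := sq_pos_of_ne_zero h.ne_zero
  refine ⟨ε * H ^ 2 / monomial (m - 1) 1, by positivity, fun y hy hyx => ?_⟩
  obtain ⟨K, hK, hF⟩ := h.rapid.exists_taylor hm
    (abs_div_le_one h.ne_zero (h.dist_le x hx)) (abs_div_le_one h.ne_zero (h.dist_le y hy))
    (h.hasWSum x hx) (h.hasWSum y hy) hd
  have hremainder : F y - F x - d / H * (y - x) = K * ((y - x) ^ 2 / H ^ 2) := by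
    rw [hF, ← sub_div, sub_sub_sub_cancel_right]
    ring
  have hKM : |K| < monomial (m - 1) 1 := hK.abs_lt_monomial (by linarith) one_pos
  rw [lt_div_iff₀ hM] at hyx
  rw [hremainder, abs_mul, abs_of_nonneg (by positivity : 0 ≤ (y - x) ^ 2 / H ^ 2),
    ← sq_abs (y - x), ← mul_div_assoc, div_le_iff₀ hH2]
  calc |K| * |y - x| ^ 2 ≤ monomial (m - 1) 1 * |y - x| ^ 2 := by gcongr
    _ = |y - x| * monomial (m - 1) 1 * |y - x| := by ring
    _ ≤ ε * H ^ 2 * |y - x| := by gcongr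
    _ = ε * |y - x| * H ^ 2 := by ring

theorem IsSimpleOn.tendsto {F : LeviCivita → LeviCivita} {I : Interval}
    (h : IsSimpleOn F I.closed) {x : LeviCivita} (hx : x ∈ Set.Icc I.left I.right) :
    Tendsto F (𝓝[Set.Icc I.left I.right] x) (𝓝 (F x)) := by
  rcases I.left_le_right.eq_or_lt with hI | hI
  · rw [← hI, Set.Icc_self] at hx ⊢
    rw [Set.mem_singleton_iff.1 hx, nhdsWithin_singleton]
    exact tendsto_pure_nhds F _
  obtain ⟨v, hrep⟩ := h.exists_rep_midpoint hI
  obtain ⟨d, hd⟩ := hrep.rapid.exists_hasWSum_deriv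
    (abs_div_le_one hrep.ne_zero (hrep.dist_le x hx))
  obtain ⟨δ, hδ, hδF⟩ := hrep.exists_deriv hx hd one_pos
  set c := d / ((I.closed.right - I.closed.left) / 2)
  rw [LinearOrderedAddCommGroup.tendsto_nhds]
  intro ε hε
  have hc : 0 < 1 + |c| := by positivity
  filter_upwards [mem_nhdsWithin_of_mem_nhds
    (eventually_abs_sub_lt x (lt_min hδ (div_pos hε hc))), self_mem_nhdsWithin] with y hy hyI
  replace hy : |y - x| < min δ (ε / (1 + |c|)) := hy
  obtain ⟨hyδ, hyε⟩ := lt_min_iff.1 hy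
  rw [lt_div_iff₀ hc] at hyε
  calc |F y - F x| = |(F y - F x - c * (y - x)) + c * (y - x)| := by rw [sub_add_cancel]
    _ ≤ |F y - F x - c * (y - x)| + |c| * |y - x| := (abs_add_le _ _).trans_eq (by rw [abs_mul])
    _ ≤ 1 * |y - x| + |c| * |y - x| := by gcongr; exact hδF y hyI hyδ
    _ < ε := by linarith

theorem eq_of_deriv {F : LeviCivita → LeviCivita} {a b x c c' : LeviCivita}
    (hx : x ∈ Set.Ioo a b)
    (h : ∀ ε : LeviCivita, 0 < ε → ∃ δ : LeviCivita, 0 < δ ∧ ∀ y ∈ Set.Ioo a b,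
      |y - x| < δ → |F y - F x - c * (y - x)| ≤ ε * |y - x|)
    (h' : ∀ ε : LeviCivita, 0 < ε → ∃ δ : LeviCivita, 0 < δ ∧ ∀ y ∈ Set.Ioo a b,
      |y - x| < δ → |F y - F x - c' * (y - x)| ≤ ε * |y - x|) : c = c' := by
  by_contra hne
  have hpos : 0 < |c - c'| := abs_pos.2 (sub_ne_zero.2 hne)
  obtain ⟨δ, hδ, hc⟩ := h (|c - c'| / 4) (by positivity)
  obtain ⟨δ', hδ', hc'⟩ := h' (|c - c'| / 4) (by positivity)
  obtain ⟨y, hxy, hy⟩ := exists_between (lt_min hx.2 (lt_min (lt_add_of_pos_right x hδ)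
    (lt_add_of_pos_right x hδ')))
  rw [lt_min_iff, lt_min_iff] at hy
  have hyx : 0 < y - x := sub_pos.2 hxy
  have hyI : y ∈ Set.Ioo a b := ⟨hx.1.trans hxy, hy.1⟩
  have hcy := hc y hyI (by rw [abs_of_pos hyx]; linarith [hy.2.1])
  have hcy' := hc' y hyI (by rw [abs_of_pos hyx]; linarith [hy.2.2])
  have htri : |(c - c') * (y - x)| ≤
      |F y - F x - c' * (y - x)| + |F y - F x - c * (y - x)| := by
    rw [show (c - c') * (y - x) =
      (F y - F x - c' * (y - x)) - (F y - F x - c * (y - x)) by ring]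
    exact abs_sub _ _
  rw [abs_mul, abs_of_pos hyx] at htri
  rw [abs_of_pos hyx] at hcy hcy'
  nlinarith [mul_pos hpos hyx]

theorem continuousOn_tsum_mul_pow {c : ℕ → ℝ} (hc : Summable fun n => |c n|) :
    ContinuousOn (fun t : ℝ => ∑' n, c n * t ^ n) (Set.Icc (-1) 1) := by
  refine continuousOn_tsum (fun n => by fun_prop) hc fun n t ht => ?_
  rw [Real.norm_eq_abs, abs_mul, abs_pow]
  exact mul_le_of_le_one_right (abs_nonneg _) (pow_le_one₀ (abs_nonneg t) (abs_le.2 ht))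

theorem hasDerivAt_tsum_mul_pow {c : ℕ → ℝ} (hc : Summable fun n : ℕ => |c n| * n) {t : ℝ}
    (ht : t ∈ Set.Ioo (-1 : ℝ) 1) :
    HasDerivAt (fun t : ℝ => ∑' n, c n * t ^ n) (∑' n : ℕ, c n * (n * t ^ (n - 1))) t := by
  refine hasDerivAt_tsum_of_isPreconnected hc isOpen_Ioo isPreconnected_Ioo
    (fun n y _ => (hasDerivAt_pow n y).const_mul (c n)) (fun n y hy => ?_)
    (y₀ := 0) (by simp) ?_ ht
  · rw [Real.norm_eq_abs, abs_mul, abs_mul, abs_pow, Nat.abs_cast]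
    gcongr
    exact mul_le_of_le_one_right (Nat.cast_nonneg n)
      (pow_le_one₀ (abs_nonneg y) (abs_le.2 ⟨hy.1.le, hy.2.le⟩))
  · exact summable_of_ne_finset_zero (s := {0}) fun n hn => by
      rw [zero_pow (by simpa using hn), mul_zero]

theorem monotoneOn_of_hasDerivAt_nonneg {φ ψ : ℝ → ℝ} {a b : ℝ}
    (hc : ContinuousOn φ (Set.Icc a b)) (hd : ∀ t ∈ Set.Ioo a b, HasDerivAt φ (ψ t) t)
    (h0 : ∀ t ∈ Set.Ioo a b, 0 ≤ ψ t) : MonotoneOn φ (Set.Icc a b) := by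
  refine monotoneOn_of_deriv_nonneg (convex_Icc a b) hc ?_ ?_ <;> rw [interior_Icc]
  · exact fun t ht => (hd t ht).differentiableAt.differentiableWithinAt
  · exact fun t ht => (hd t ht).deriv ▸ h0 t ht

theorem deriv_eq_zero_of_nonneg_of_le {φ ψ : ℝ → ℝ} {a b : ℝ}
    (hc : ContinuousOn φ (Set.Icc a b)) (hd : ∀ t ∈ Set.Ioo a b, HasDerivAt φ (ψ t) t)
    (h0 : ∀ t ∈ Set.Ioo a b, 0 ≤ ψ t) (hle : φ b ≤ φ a) {t : ℝ} (ht : t ∈ Set.Ioo a b) :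
    ψ t = 0 := by
  have hmono := monotoneOn_of_hasDerivAt_nonneg hc hd h0
  have hab := (ht.1.trans ht.2).le
  have hconst : φ =ᶠ[𝓝 t] fun _ => φ a := by
    filter_upwards [Icc_mem_nhds ht.1 ht.2] with s hs
    exact le_antisymm ((hmono hs (Set.right_mem_Icc.2 hab) hs.2).trans hle)
      (hmono (Set.left_mem_Icc.2 hab) hs hs.1)
  exact (hd t ht).unique ((hasDerivAt_const t (φ a)).congr_of_eventuallyEq hconst)

theorem le_of_coeff_hasDerivAt_nonneg {Φ Ψ : ℝ → LeviCivita} {a b : ℝ} (hab : a ≤ b) {S : Set ℚ}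
    (hS : LeftFinite S) (hΨ : ∀ t ∈ Set.Ioo a b, HasSupp S (Ψ t))
    (hc : ∀ q, ContinuousOn (fun t => coeff (Φ t) q) (Set.Icc a b))
    (hd : ∀ q, ∀ t ∈ Set.Ioo a b, HasDerivAt (fun t => coeff (Φ t) q) (coeff (Ψ t) q) t)
    (h0 : ∀ t ∈ Set.Ioo a b, 0 ≤ Ψ t) : Φ a ≤ Φ b := by
  by_contra! hlt
  obtain ⟨q₁, heq, hq₁⟩ := lt_iff_coeff.1 hlt
  have hle : ∀ q ≤ q₁, coeff (Φ b) q ≤ coeff (Φ a) q := fun q hq => by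
    rcases hq.eq_or_lt with rfl | hq
    · exact hq₁.le
    · exact (heq q hq).le
  have hvanish : {q | q ≤ q₁ ∧ ∃ t ∈ Set.Ioo a b, coeff (Ψ t) q ≠ 0} = ∅ := by
    set Bad := {q | q ≤ q₁ ∧ ∃ t ∈ Set.Ioo a b, coeff (Ψ t) q ≠ 0}
    have hBadS : Bad ⊆ S := by
      rintro q ⟨-, t, ht, hq⟩
      exact hΨ t ht q hq
    by_contra! hne
    have hwf := Set.isPWO_iff_isWF.1 (hS.mono hBadS).isPWO
    obtain ⟨hq₀, t, ht, hqt⟩ := hwf.min_mem hne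
    refine hqt (deriv_eq_zero_of_nonneg_of_le (hc _) (hd _) (fun s hs => ?_) (hle _ hq₀) ht)
    refine coeff_nonneg_of_nonneg (h0 s hs) fun q hq => ?_
    by_contra hqs
    exact hwf.not_lt_min hne (⟨hq.le.trans hq₀, s, hs, hqs⟩ : q ∈ Bad) hq
  have hmono := monotoneOn_of_hasDerivAt_nonneg (hc q₁) (hd q₁) fun t ht => by
    by_contra! hneg
    exact Set.notMem_empty q₁ (hvanish ▸ ⟨le_rfl, t, ht, hneg.ne⟩)
  exact absurd (hmono (Set.left_mem_Icc.2 hab) (Set.right_mem_Icc.2 hab) hab) (not_le.2 hq₁)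

theorem Rapid.hasDerivAt_coeff {v : ℕ → LeviCivita} (hv : Rapid v) {Φ : ℝ → LeviCivita}
    (hΦ : ∀ t ∈ Set.Icc (-1 : ℝ) 1, HasWSum (fun n => v n * ofReal t ^ n) (Φ t)) {t : ℝ}
    (ht : t ∈ Set.Ioo (-1 : ℝ) 1) {d : LeviCivita}
    (hd : HasWSum (fun n => v n * (n * ofReal t ^ (n - 1))) d) (q : ℚ) :
    HasDerivAt (fun t => coeff (Φ t) q) (coeff d q) t := by
  have hterm : ∀ n, coeff (v n * (n * ofReal t ^ (n - 1))) q =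
      coeff (v n) q * (n * t ^ (n - 1)) := fun n => by
    rw [mul_left_comm, coeff_natCast_mul, coeff_mul_ofReal_pow]
    ring
  have hdq := hd.hasSum q
  simp only [hterm] at hdq
  rw [← hdq.tsum_eq]
  have hsummable : Summable fun n : ℕ => |coeff (v n) q| * n :=
    (hv.summable q 1).of_nonneg_of_le (fun n => by positivity) fun n => by
      rw [pow_one, mul_comm]
      gcongr
      linarith
  refine (hasDerivAt_tsum_mul_pow hsummable ht).congr_of_eventuallyEq ?_
  filter_upwards [Icc_mem_nhds ht.1 ht.2] with s hs
  simpa only [coeff_mul_ofReal_pow] using ((hΦ s hs).hasSum q).tsum_eq.symm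

theorem Rapid.continuousOn_coeff {v : ℕ → LeviCivita} (hv : Rapid v) {Φ : ℝ → LeviCivita}
    (hΦ : ∀ t ∈ Set.Icc (-1 : ℝ) 1, HasWSum (fun n => v n * ofReal t ^ n) (Φ t)) (q : ℚ) :
    ContinuousOn (fun t => coeff (Φ t) q) (Set.Icc (-1) 1) := by
  have hsummable : Summable fun n => |coeff (v n) q| := by simpa using hv.summable q 0
  refine (continuousOn_tsum_mul_pow hsummable).congr fun t ht => ?_
  simpa only [coeff_mul_ofReal_pow] using ((hΦ t ht).hasSum q).tsum_eq.symm

/-- The affine parametrization of `I` by `[-1, 1]`, along real parameters: `param t` is the point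
where the normalized variable of an expansion about the midpoint takes the value `t`. -/
noncomputable def Interval.param (I : Interval) (t : ℝ) : LeviCivita :=
  I.midpoint + (I.right - I.left) / 2 * ofReal t

theorem Interval.param_mem_Ioo {I : Interval} (hI : I.left < I.right) {t : ℝ}
    (ht : t ∈ Set.Ioo (-1 : ℝ) 1) : I.param t ∈ Set.Ioo I.left I.right := by
  have hleft := ofReal_lt ht.1
  have hright := ofReal_lt ht.2
  rw [ofReal_neg, ofReal_one] at hleft
  rw [ofReal_one] at hright
  rw [Interval.param, Interval.midpoint]
  constructor <;> nlinarith

theorem Interval.param_mem_Icc (I : Interval) {t : ℝ} (ht : t ∈ Set.Icc (-1 : ℝ) 1) :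
    I.param t ∈ Set.Icc I.left I.right := by
  have hI := I.left_le_right
  have hleft := ofReal_le ht.1
  have hright := ofReal_le ht.2
  rw [ofReal_neg, ofReal_one] at hleft
  rw [ofReal_one] at hright
  rw [Interval.param, Interval.midpoint]
  constructor <;> nlinarith

theorem Interval.param_neg_one (I : Interval) : I.param (-1) = I.left := by
  rw [Interval.param, Interval.midpoint, ofReal_neg, ofReal_one]
  ring

theorem Interval.param_one (I : Interval) : I.param 1 = I.right := by
  rw [Interval.param, Interval.midpoint, ofReal_one]
  ring

theorem Interval.param_sub_midpoint_div {I : Interval} (hI : I.left < I.right) (t : ℝ) :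
    (I.param t - I.midpoint) / ((I.right - I.left) / 2) = ofReal t := by
  rw [Interval.param, add_sub_cancel_left, mul_div_cancel_left₀]
  linarith

theorem Rep.hasWSum_deriv {F f : LeviCivita → LeviCivita} {I : Interval} {x₀ H : LeviCivita}
    {v : ℕ → LeviCivita} (h : Rep F (Set.Icc I.left I.right) x₀ H v) (hd : IsDerivOn F f I)
    {x : LeviCivita} (hx : x ∈ Set.Ioo I.left I.right) :
    HasWSum (fun n => v n * (n * ((x - x₀) / H) ^ (n - 1))) (H * f x) := by
  have hxI : x ∈ Set.Icc I.left I.right := Set.Ioo_subset_Icc_self hx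
  obtain ⟨d, hdsum⟩ := h.rapid.exists_hasWSum_deriv
    (abs_div_le_one h.ne_zero (h.dist_le x hxI))
  have heq : d / H = f x := by
    refine eq_of_deriv (F := F) hx (fun ε hε => ?_) fun ε hε => ?_
    · obtain ⟨δ, hδ, hF⟩ := h.exists_deriv hxI hdsum hε
      exact ⟨δ, hδ, fun y hy => hF y (Set.Ioo_subset_Icc_self hy)⟩
    · obtain ⟨δ, hδ, hF⟩ := hd x (I.Ioo_subset hx) ε hε
      exact ⟨δ, hδ, fun y hy => hF y (I.Ioo_subset hy)⟩
  rwa [← heq, mul_div_cancel₀ _ h.ne_zero]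

theorem le_of_isDerivOn_nonneg {G g : LeviCivita → LeviCivita} {I : Interval}
    (hG : IsSimpleOn G I.closed) (hd : IsDerivOn G g I) (h0 : ∀ x ∈ I.carrier, 0 ≤ g x) :
    G I.left ≤ G I.right := by
  rcases I.left_le_right.eq_or_lt with hI | hI
  · rw [hI]
  obtain ⟨v, hrep⟩ : ∃ v, Rep G (Set.Icc I.left I.right) I.midpoint ((I.right - I.left) / 2) v :=
    hG.exists_rep_midpoint hI
  have hΦ : ∀ t ∈ Set.Icc (-1 : ℝ) 1, HasWSum (fun n => v n * ofReal t ^ n) (G (I.param t)) :=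
    fun t ht => by
      simpa only [Interval.param_sub_midpoint_div hI] using hrep.hasWSum _ (I.param_mem_Icc ht)
  have hΨ : ∀ t ∈ Set.Ioo (-1 : ℝ) 1, HasWSum (fun n => v n * (n * ofReal t ^ (n - 1)))
      ((I.right - I.left) / 2 * g (I.param t)) := fun t ht => by
    simpa only [Interval.param_sub_midpoint_div hI] using
      hrep.hasWSum_deriv hd (Interval.param_mem_Ioo hI ht)
  obtain ⟨S, hS, hvS⟩ := hrep.rapid.regular
  have hsupp : ∀ t ∈ Set.Ioo (-1 : ℝ) 1, HasSupp S ((I.right - I.left) / 2 * g (I.param t)) :=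
    fun t ht => (hΨ t ht).hasSupp fun n q hq => hvS n q fun hv => hq (by
      rw [mul_left_comm, coeff_natCast_mul, coeff_mul_ofReal_pow, hv, zero_mul, mul_zero])
  rw [← I.param_neg_one, ← I.param_one]
  exact le_of_coeff_hasDerivAt_nonneg (by norm_num) hS hsupp (hrep.rapid.continuousOn_coeff hΦ)
    (fun q t ht => hrep.rapid.hasDerivAt_coeff hΦ ht (hΨ t ht) q)
    (fun t ht => mul_nonneg (by linarith) (h0 _ (I.Ioo_subset (Interval.param_mem_Ioo hI ht))))

/-! ### Antiderivatives -/

theorem IsDerivOn.sub {F G f g : LeviCivita → LeviCivita} {I : Interval} (hF : IsDerivOn F f I)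
    (hG : IsDerivOn G g I) : IsDerivOn (fun x => F x - G x) (fun x => f x - g x) I := by
  intro x hx ε hε
  obtain ⟨δ, hδ, hF⟩ := hF x hx (ε / 2) (half_pos hε)
  obtain ⟨δ', hδ', hG⟩ := hG x hx (ε / 2) (half_pos hε)
  refine ⟨min δ δ', lt_min hδ hδ', fun y hy hyx => ?_⟩
  calc |F y - G y - (F x - G x) - (f x - g x) * (y - x)|
      = |(F y - F x - f x * (y - x)) - (G y - G x - g x * (y - x))| := by ring_nf
    _ ≤ |F y - F x - f x * (y - x)| + |G y - G x - g x * (y - x)| := abs_sub _ _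
    _ ≤ ε / 2 * |y - x| + ε / 2 * |y - x| :=
      add_le_add (hF y hy (hyx.trans_le (min_le_left _ _)))
        (hG y hy (hyx.trans_le (min_le_right _ _)))
    _ = ε * |y - x| := by ring

/-- `F` is a simple antiderivative of `f` on `I`, as used to integrate simple functions. The
antiderivative is required to be simple on the closed interval, so that it has values at the
endpoints. -/
structure IsAntiderivOn (F f : LeviCivita → LeviCivita) (I : Interval) : Prop where
  simple : IsSimpleOn F I.closed
  deriv : IsDerivOn F f I

namespace IsAntiderivOn

variable {F G f g : LeviCivita → LeviCivita} {I J : Interval}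

theorem sub (hF : IsAntiderivOn F f I) (hG : IsAntiderivOn G g I) :
    IsAntiderivOn (fun x => F x - G x) (fun x => f x - g x) I :=
  ⟨hF.simple.sub hG.simple, hF.deriv.sub hG.deriv⟩

theorem of_left_eq_right (F f : LeviCivita → LeviCivita) (h : I.left = I.right) :
    IsAntiderivOn F f I := by
  refine ⟨isSimpleOn_of_left_eq_right F h, fun x hx ε _ => ⟨1, one_pos, fun y hy _ => ?_⟩⟩
  have hx' := I.subset_Icc hx
  have hy' := I.subset_Icc hy
  rw [← h, Set.Icc_self, Set.mem_singleton_iff] at hx' hy'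
  simp [hx', hy']

theorem restrict (hF : IsAntiderivOn F f I) (hJI : J.carrier ⊆ I.carrier) :
    IsAntiderivOn F f J := by
  rcases J.left_le_right.eq_or_lt with hJ | hJ
  · exact of_left_eq_right F f hJ
  obtain ⟨hl, hr⟩ := Interval.Icc_subset_Icc hJI hJ
  refine ⟨hF.simple.restrict (Set.Icc_subset_Icc hl hr), fun x hx ε hε => ?_⟩
  obtain ⟨δ, hδ, h⟩ := hF.deriv x (hJI hx) ε hε
  exact ⟨δ, hδ, fun y hy => h y (hJI hy)⟩

theorem linear (B : LeviCivita) (I : Interval) : IsAntiderivOn (fun x => B * x) (fun _ => B) I := by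
  refine ⟨⟨I.left, ⟨le_rfl, I.left_le_right⟩,
    fun n => if n = 0 then B * I.left else if n = 1 then B else 0, fun x _ => ?_⟩,
    fun x _ ε hε => ⟨1, one_pos, fun y _ _ => ?_⟩⟩
  · have hsum := (hasWSum_of_finite (w := fun n => (if n = 0 then B * I.left else
      if n = 1 then B else 0) * (x - I.left) ^ n) (N := 2)
      (fun n hn => by rw [if_neg (by omega), if_neg (by omega), zero_mul])).weakTendsto
    have heq : B * I.left + B * (x - I.left) = B * x := by ring
    simpa [Finset.sum_range_succ, heq] using hsum
  · rw [← mul_sub, sub_self, abs_zero]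
    positivity

theorem le (hF : IsAntiderivOn F f I) (hG : IsAntiderivOn G g I) (h : ∀ x ∈ I.carrier, f x ≤ g x) :
    F I.right - F I.left ≤ G I.right - G I.left := by
  have hmono : G I.left - F I.left ≤ G I.right - F I.right :=
    le_of_isDerivOn_nonneg (hG.sub hF).simple (hG.sub hF).deriv fun x hx => sub_nonneg.2 (h x hx)
  linarith

end IsAntiderivOn

theorem HasWSum.nat_succ {w : ℕ → LeviCivita} {s : LeviCivita} (h : HasWSum w s) (h0 : w 0 = 0) :
    HasWSum (fun n => w (n + 1)) s := by
  obtain ⟨S, hS, hw⟩ := h.regular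
  refine ⟨⟨S, hS, fun n => hw (n + 1)⟩, fun q => ?_⟩
  have := (hasSum_nat_add_iff' 1).2 (h.hasSum q)
  simpa [h0, coeff_zero] using this

theorem Rapid.antideriv {v : ℕ → LeviCivita} (hv : Rapid v) (H : LeviCivita) :
    Rapid fun n => ofReal (n : ℝ)⁻¹ * (H * v (n - 1)) := by
  have hvH : Rapid fun n => v n * H := hv.mul_polyGrowth
    ⟨⟨_, leftFinite_supp H, fun _ _ h => h⟩, fun q => ⟨|coeff H q|, 0, fun n => by simp⟩⟩
  obtain ⟨S, hS, hvS⟩ := hvH.regular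
  have hle : ∀ (n : ℕ) (q : ℚ), |coeff (ofReal (n : ℝ)⁻¹ * (H * v (n - 1))) q| ≤
      |coeff (v (n - 1) * H) q| := by
    intro n q
    rw [coeff_ofReal_mul, mul_comm H, abs_mul]
    refine mul_le_of_le_one_left (abs_nonneg _) ?_
    rw [abs_of_nonneg (by positivity)]
    exact Nat.cast_inv_le_one n
  refine ⟨⟨S, hS, fun n q hq => hvS (n - 1) q fun h0 => hq ?_⟩, fun q k => ?_⟩
  · have := hle n q
    rw [h0, abs_zero] at this
    exact abs_nonpos_iff.1 this
  · rw [← summable_nat_add_iff 1]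
    refine Summable.of_nonneg_of_le (fun n => by positivity) (fun n => ?_)
      ((hvH.summable q k).mul_left (2 ^ k))
    rw [← mul_assoc (2 ^ k : ℝ), ← _root_.mul_pow]
    refine mul_le_mul ?_ (hle (n + 1) q) (abs_nonneg _) (by positivity)
    gcongr
    push_cast
    linarith [n.cast_nonneg (α := ℝ)]

theorem Rapid.hasWSum_deriv_antideriv {v : ℕ → LeviCivita} (hv : Rapid v) (H : LeviCivita)
    {z s : LeviCivita} (hz : |z| ≤ 1) (hs : HasWSum (fun n => v n * z ^ n) s) :
    HasWSum (fun n : ℕ => ofReal (n : ℝ)⁻¹ * (H * v (n - 1)) * (n * z ^ (n - 1))) (H * s) := by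
  obtain ⟨d, hd⟩ := (hv.antideriv H).exists_hasWSum_deriv hz
  have hshift : HasWSum (fun n => H * (v n * z ^ n)) d := by
    convert hd.nat_succ (by simp) using 2 with n
    have hn : ofReal ((n + 1 : ℕ) : ℝ)⁻¹ * ((n + 1 : ℕ) : LeviCivita) = 1 := by
      rw [← ofReal_natCast, ← LC.ofReal_mul, inv_mul_cancel₀ (by positivity), ofReal_one]
    rw [Nat.add_sub_cancel]
    linear_combination (-(H * v n * z ^ n)) * hn
  rwa [← hshift.unique (hs.mul_left H)]

theorem IsSimpleOn.exists_isAntiderivOn {f : LeviCivita → LeviCivita} {I : Interval}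
    (h : IsSimpleOn f I) : ∃ F, IsAntiderivOn F f I := by
  rcases I.left_le_right.eq_or_lt with hI | hI
  · exact ⟨0, IsAntiderivOn.of_left_eq_right _ _ hI⟩
  obtain ⟨x₀, hx₀, H, v, hdist, hrep⟩ := h.exists_rep hI
  have hz : ∀ x ∈ Set.Icc I.left I.right, |(x - x₀) / H| ≤ 1 := fun x hx =>
    abs_div_le_one hrep.ne_zero (hdist x hx)
  choose! F hF using fun x hx => (hrep.rapid.antideriv H).exists_hasWSum_pow (hz x hx)
  have hFrep : Rep F (Set.Icc I.left I.right) x₀ H fun n => ofReal (n : ℝ)⁻¹ * (H * v (n - 1)) :=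
    ⟨hrep.ne_zero, hrep.rapid.antideriv H, hdist, hF⟩
  refine ⟨F, Rep.isSimpleOn (I := I.closed) hFrep hx₀, fun x hx ε hε => ?_⟩
  have hxI := I.subset_Icc hx
  obtain ⟨δ, hδ, hderiv⟩ := hFrep.exists_deriv hxI
    (hrep.rapid.hasWSum_deriv_antideriv H (hz x hxI) (hrep.hasWSum x hx)) hε
  rw [mul_div_cancel_left₀ _ hrep.ne_zero] at hderiv
  exact ⟨δ, hδ, fun y hy => hderiv y (I.subset_Icc hy)⟩

theorem IsSimpleOn.exists_bound {f : LeviCivita → LeviCivita} {I : Interval}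
    (h : IsSimpleOn f I) : ∃ B, 0 < B ∧ ∀ x ∈ I.carrier, |f x| ≤ B := by
  rcases I.left_le_right.eq_or_lt with hI | hI
  · refine ⟨|f I.left| + 1, by positivity, fun x hx => ?_⟩
    have hx' := I.subset_Icc hx
    rw [← hI, Set.Icc_self, Set.mem_singleton_iff] at hx'
    rw [hx']
    linarith
  obtain ⟨x₀, -, H, v, -, hrep⟩ := h.exists_rep hI
  obtain ⟨m, hm⟩ := hrep.rapid.regular.exists_suppGE
  refine ⟨monomial (m - 1) 1, monomial_pos _ one_pos, fun x hx => ?_⟩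
  have hz : SuppGE 0 ((x - x₀) / H) := by
    have := abs_div_le_one hrep.ne_zero (hrep.dist_le x hx)
    rw [← ofReal_one] at this
    exact suppGE_of_abs_le_ofReal this
  have hfx : SuppGE m (f x) := (hrep.hasWSum x hx).suppGE fun n => by
    simpa using (hm n).mul (hz.pow_zero n)
  exact (hfx.abs_lt_monomial (by linarith) one_pos).le

/-! ### The integral of a simple function -/

theorem hasSimpleIntegral_iff {f : LeviCivita → LeviCivita} {I : Interval} {v : LeviCivita} :
    HasSimpleIntegral f I v ↔
      IsSimpleOn f I ∧ ∃ F, IsAntiderivOn F f I ∧ v = F I.right - F I.left := by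
  have hl : I.left ∈ Set.Icc I.left I.right := ⟨le_rfl, I.left_le_right⟩
  have hr : I.right ∈ Set.Icc I.left I.right := ⟨I.left_le_right, le_rfl⟩
  refine and_congr_right fun _ => exists_congr fun F => ⟨?_, ?_⟩
  · rintro ⟨hs, hd, α, β, hα, hβ, rfl⟩
    have : (𝓝[Set.Icc I.left I.right] I.left).NeBot := mem_closure_iff_nhdsWithin_neBot.1
      (subset_closure hl)
    have : (𝓝[Set.Icc I.left I.right] I.right).NeBot := mem_closure_iff_nhdsWithin_neBot.1
      (subset_closure hr)
    rw [tendsto_nhds_unique hα (hs.tendsto hl), tendsto_nhds_unique hβ (hs.tendsto hr)]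
    exact ⟨⟨hs, hd⟩, rfl⟩
  · rintro ⟨hF, rfl⟩
    exact ⟨hF.simple, hF.deriv, _, _, hF.simple.tendsto hl, hF.simple.tendsto hr, rfl⟩

open scoped Classical in
/-- The value of the integral of `f` over `I`, which exists when `f` is simple on `I`; it is `0`
when there is no such value. -/
noncomputable def simpleIntegral (f : LeviCivita → LeviCivita) (I : Interval) : LeviCivita :=
  if h : ∃ v, HasSimpleIntegral f I v then h.choose else 0

section SimpleIntegral

variable {F f g : LeviCivita → LeviCivita} {I : Interval}

theorem IsAntiderivOn.simpleIntegral_eq (hF : IsAntiderivOn F f I) (hf : IsSimpleOn f I) :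
    simpleIntegral f I = F I.right - F I.left := by
  have h : ∃ v, HasSimpleIntegral f I v := ⟨_, hasSimpleIntegral_iff.2 ⟨hf, F, hF, rfl⟩⟩
  rw [simpleIntegral, dif_pos h]
  obtain ⟨-, G, hG, hv⟩ := hasSimpleIntegral_iff.1 h.choose_spec
  rw [hv]
  exact le_antisymm (hG.le hF fun _ _ => le_rfl) (hF.le hG fun _ _ => le_rfl)

theorem HasSimpleIntegral.eq {v : LeviCivita} (h : HasSimpleIntegral f I v) :
    v = simpleIntegral f I := by
  obtain ⟨hf, F, hF, rfl⟩ := hasSimpleIntegral_iff.1 h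
  exact (hF.simpleIntegral_eq hf).symm

theorem IsSimpleOn.hasSimpleIntegral (hf : IsSimpleOn f I) :
    HasSimpleIntegral f I (simpleIntegral f I) := by
  obtain ⟨F, hF⟩ := hf.exists_isAntiderivOn
  rw [hF.simpleIntegral_eq hf]
  exact hasSimpleIntegral_iff.2 ⟨hf, F, hF, rfl⟩

theorem simpleIntegral_mono (hf : IsSimpleOn f I) (hg : IsSimpleOn g I)
    (h : ∀ x ∈ I.carrier, f x ≤ g x) : simpleIntegral f I ≤ simpleIntegral g I := by
  obtain ⟨F, hF⟩ := hf.exists_isAntiderivOn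
  obtain ⟨G, hG⟩ := hg.exists_isAntiderivOn
  rw [hF.simpleIntegral_eq hf, hG.simpleIntegral_eq hg]
  exact hF.le hG h

theorem simpleIntegral_sub (hf : IsSimpleOn f I) (hg : IsSimpleOn g I) :
    simpleIntegral (fun x => f x - g x) I = simpleIntegral f I - simpleIntegral g I := by
  obtain ⟨F, hF⟩ := hf.exists_isAntiderivOn
  obtain ⟨G, hG⟩ := hg.exists_isAntiderivOn
  rw [hF.simpleIntegral_eq hf, hG.simpleIntegral_eq hg, (hF.sub hG).simpleIntegral_eq (hf.sub hg)]
  ring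

theorem simpleIntegral_const (c : LeviCivita) (I : Interval) :
    simpleIntegral (fun _ => c) I = c * I.length := by
  rw [(IsAntiderivOn.linear c I).simpleIntegral_eq (isSimpleOn_const c I), Interval.length]
  ring

theorem abs_simpleIntegral_le (hf : IsSimpleOn f I) (hg : IsSimpleOn g I)
    (h : ∀ x ∈ I.carrier, |f x| ≤ g x) : |simpleIntegral f I| ≤ simpleIntegral g I := by
  refine abs_le'.2
    ⟨simpleIntegral_mono hf hg fun x hx => (le_abs_self _).trans (h x hx), ?_⟩
  calc -simpleIntegral f I
      = simpleIntegral (fun x => 0 - f x) I := by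
        rw [simpleIntegral_sub (isSimpleOn_const 0 I) hf, simpleIntegral_const, zero_mul, zero_sub]
    _ ≤ simpleIntegral g I := simpleIntegral_mono ((isSimpleOn_const 0 I).sub hf) hg fun x hx =>
        (zero_sub (f x)).le.trans ((neg_le_abs _).trans (h x hx))

theorem simpleIntegral_of_left_eq_right (h : I.left = I.right) : simpleIntegral f I = 0 := by
  rw [(IsAntiderivOn.of_left_eq_right 0 f h).simpleIntegral_eq (isSimpleOn_of_left_eq_right f h)]
  simp

end SimpleIntegral

/-! ### Subdivisions of finite families of intervals -/

theorem exists_monotone_range {α : Type*} [LinearOrder α] [Nonempty α] (P : Finset α) :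
    ∃ p : ℕ → α, Monotone p ∧ ∀ x ∈ P, ∃ n, p n = x := by
  rcases P.eq_empty_or_nonempty with rfl | hP
  · exact ⟨fun _ => Classical.arbitrary α, monotone_const, by simp⟩
  have hlt : ∀ n, min n (P.card - 1) < P.card := fun n => by
    have := hP.card_pos
    omega
  refine ⟨fun n => P.orderEmbOfFin rfl ⟨min n (P.card - 1), hlt n⟩,
    fun m n hmn => (P.orderEmbOfFin rfl).monotone (min_le_min_right _ hmn), fun x hx => ?_⟩
  obtain ⟨i, rfl⟩ : x ∈ Set.range (P.orderEmbOfFin rfl) := by rwa [Finset.range_orderEmbOfFin]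
  exact ⟨i, congrArg _ (Fin.ext (min_eq_left (Nat.le_sub_one_of_lt i.2)))⟩

/-- The open interval between two consecutive points of a monotone sequence. Common refinements of
families of intervals are made of these atoms; dropping the endpoints does not change integrals. -/
def atom (p : ℕ → LeviCivita) (hp : Monotone p) (n : ℕ) : Interval where
  left := p n
  right := p (n + 1)
  left_le_right := hp n.le_succ
  carrier := Set.Ioo (p n) (p (n + 1))
  Ioo_subset := subset_rfl
  subset_Icc := Set.Ioo_subset_Icc_self

theorem atom_mutuallyDisjoint {p : ℕ → LeviCivita} (hp : Monotone p) :
    MutuallyDisjoint (atom p hp) :=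
  hp.pairwise_disjoint_on_Ioo_succ

/-- The atoms with indices in `X` are nonempty and subdivide the interval `I`. That they fill `I`
is encoded by the telescoping of every function `G`. -/
structure Subdivides (p : ℕ → LeviCivita) (X : Finset ℕ) (I : Interval) : Prop where
  lt : ∀ n ∈ X, p n < p (n + 1)
  le : ∀ n ∈ X, I.left ≤ p n ∧ p (n + 1) ≤ I.right
  sum : ∀ G : LeviCivita → LeviCivita,
    ∑ n ∈ X, (G (p (n + 1)) - G (p n)) = G I.right - G I.left

/-- The total length of a finite family of intervals. -/
noncomputable def totalLength (L : ℕ → Interval) (X : Finset ℕ) : LeviCivita :=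
  ∑ k ∈ X, (L k).length

/-- The sum of the integrals of `f` over a finite family of intervals, for `f` simple on each. -/
noncomputable def totalIntegral (f : LeviCivita → LeviCivita) (L : ℕ → Interval) (X : Finset ℕ) :
    LeviCivita :=
  ∑ k ∈ X, simpleIntegral f (L k)

/-- The atoms with indices in `Y` subdivide the family of intervals `L k`, `k ∈ X`. That they fill
it is encoded by the equality of the integrals of all functions simple on each `L k`. -/
structure Refines (p : ℕ → LeviCivita) (hp : Monotone p) (Y : Finset ℕ) (L : ℕ → Interval)
    (X : Finset ℕ) : Prop where
  subset : ∀ n ∈ Y, ∃ k ∈ X, (atom p hp n).carrier ⊆ (L k).carrier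
  totalIntegral_eq : ∀ f, (∀ k ∈ X, IsSimpleOn f (L k)) →
    totalIntegral f L X = totalIntegral f (atom p hp) Y

/-- The intervals `L k`, `k ∈ X`, are mutually disjoint subsets of `A` on which `f` is simple: the
finite counterpart of `simpleFamilies A f`. -/
structure SimpleFamily (A : Set LeviCivita) (f : LeviCivita → LeviCivita) (L : ℕ → Interval)
    (X : Finset ℕ) : Prop where
  disjoint : (X : Set ℕ).PairwiseDisjoint fun k => (L k).carrier
  subset : ∀ k ∈ X, (L k).carrier ⊆ A
  simple : ∀ k ∈ X, IsSimpleOn f (L k)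

section Subdivision

variable {p : ℕ → LeviCivita} {hp : Monotone p} {I : Interval} {f : LeviCivita → LeviCivita}
  {A : Set LeviCivita} {L L' : ℕ → Interval} {X X' Y Y' : Finset ℕ}

theorem exists_subdivides (hp : Monotone p) (hl : ∃ n, p n = I.left) (hr : ∃ n, p n = I.right) :
    ∃ X, Subdivides p X I := by
  obtain ⟨i, hi⟩ := hl
  obtain ⟨j, hj⟩ := hr
  refine ⟨(Finset.Ico i j).filter fun n => p n < p (n + 1), fun n hn => (Finset.mem_filter.1 hn).2,
    fun n hn => ?_, fun G => ?_⟩ <;> rw [← hi, ← hj]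
  · have := Finset.mem_Ico.1 (Finset.mem_filter.1 hn).1
    exact ⟨hp this.1, hp this.2⟩
  rw [Finset.sum_filter_of_ne fun n _ hne =>
    (hp n.le_succ).lt_of_ne fun h => hne (by rw [← h, sub_self])]
  rcases le_total i j with hij | hij
  · rw [Finset.sum_Ico_eq_sub _ hij, Finset.sum_range_sub (fun n => G (p n)),
      Finset.sum_range_sub (fun n => G (p n))]
    ring
  · have hle : p i ≤ p j := hi ▸ hj ▸ I.left_le_right
    rw [Finset.Ico_eq_empty_of_le hij, Finset.sum_empty, hle.antisymm (hp hij), sub_self]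

theorem Subdivides.atom_subset (h : Subdivides p X I) {n : ℕ} (hn : n ∈ X) :
    (atom p hp n).carrier ⊆ I.carrier :=
  (Set.Ioo_subset_Ioo (h.le n hn).1 (h.le n hn).2).trans I.Ioo_subset

theorem Subdivides.simpleIntegral_eq (h : Subdivides p X I) (hf : IsSimpleOn f I) :
    simpleIntegral f I = ∑ n ∈ X, simpleIntegral f (atom p hp n) := by
  obtain ⟨F, hF⟩ := hf.exists_isAntiderivOn
  rw [hF.simpleIntegral_eq hf, ← h.sum F]
  exact Finset.sum_congr rfl fun n hn =>
    ((hF.restrict (h.atom_subset hn)).simpleIntegral_eq (hf.restrict (h.atom_subset hn))).symm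

theorem totalIntegral_const (c : LeviCivita) (L : ℕ → Interval) (X : Finset ℕ) :
    totalIntegral (fun _ => c) L X = c * totalLength L X := by
  simp only [totalIntegral, totalLength, simpleIntegral_const, Finset.mul_sum]

theorem Refines.totalLength_eq (h : Refines p hp Y L X) :
    totalLength L X = totalLength (atom p hp) Y := by
  simpa only [totalIntegral_const, one_mul] using
    h.totalIntegral_eq (fun _ => 1) fun k _ => isSimpleOn_const 1 _

theorem exists_refines (hp : Monotone p) (hd : (X : Set ℕ).PairwiseDisjoint fun k => (L k).carrier)
    (he : ∀ k ∈ X, (∃ n, p n = (L k).left) ∧ ∃ n, p n = (L k).right) :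
    ∃ Y, Refines p hp Y L X := by
  choose! S hS using fun k hk => exists_subdivides hp (he k hk).1 (he k hk).2
  refine ⟨X.biUnion S, fun n hn => ?_, fun f hf => ?_⟩
  · obtain ⟨k, hk, hn⟩ := Finset.mem_biUnion.1 hn
    exact ⟨k, hk, (hS k hk).atom_subset hn⟩
  have hdisj : (X : Set ℕ).PairwiseDisjoint S := fun i hi j hj hij =>
    Finset.disjoint_left.2 fun n hni hnj => by
      obtain ⟨x, hx⟩ := exists_between ((hS i hi).lt n hni)
      exact Set.disjoint_left.1 (hd hi hj hij) ((hS i hi).atom_subset (hp := hp) hni hx)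
        ((hS j hj).atom_subset (hp := hp) hnj hx)
  rw [totalIntegral, totalIntegral, Finset.sum_biUnion hdisj]
  exact Finset.sum_congr rfl fun k hk => (hS k hk).simpleIntegral_eq (hf k hk)

theorem exists_common_refinement (hd : (X : Set ℕ).PairwiseDisjoint fun k => (L k).carrier)
    (hd' : (X' : Set ℕ).PairwiseDisjoint fun k => (L' k).carrier) :
    ∃ (p : ℕ → LeviCivita) (hp : Monotone p) (Y Y' : Finset ℕ),
      Refines p hp Y L X ∧ Refines p hp Y' L' X' := by
  classical
  obtain ⟨p, hp, h⟩ := exists_monotone_range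
    ((X.image (fun k => (L k).left) ∪ X.image (fun k => (L k).right)) ∪
      (X'.image (fun k => (L' k).left) ∪ X'.image (fun k => (L' k).right)))
  simp only [Finset.mem_union, Finset.mem_image] at h
  obtain ⟨Y, hY⟩ := exists_refines hp hd fun k hk =>
    ⟨h _ (Or.inl (Or.inl ⟨k, hk, rfl⟩)), h _ (Or.inl (Or.inr ⟨k, hk, rfl⟩))⟩
  obtain ⟨Y', hY'⟩ := exists_refines hp hd' fun k hk =>
    ⟨h _ (Or.inr (Or.inl ⟨k, hk, rfl⟩)), h _ (Or.inr (Or.inr ⟨k, hk, rfl⟩))⟩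
  exact ⟨p, hp, Y, Y', hY, hY'⟩

theorem Interval.length_nonneg (I : Interval) : 0 ≤ I.length := sub_nonneg.2 I.left_le_right

theorem totalLength_mono (L : ℕ → Interval) (h : X ⊆ Y) : totalLength L X ≤ totalLength L Y :=
  Finset.sum_le_sum_of_subset_of_nonneg h fun k _ _ => (L k).length_nonneg

theorem SimpleFamily.mono (h : SimpleFamily A f L Y) (hXY : X ⊆ Y) : SimpleFamily A f L X :=
  ⟨h.disjoint.subset (Finset.coe_subset.2 hXY), fun k hk => h.subset k (hXY hk),
    fun k hk => h.simple k (hXY hk)⟩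

theorem SimpleFamily.const (h : SimpleFamily A f L X) (c : LeviCivita) :
    SimpleFamily A (fun _ => c) L X :=
  ⟨h.disjoint, h.subset, fun _ _ => isSimpleOn_const c _⟩

theorem SimpleFamily.of_refines (h : SimpleFamily A f L X) (hY : Refines p hp Y L X) :
    SimpleFamily A f (atom p hp) Y := by
  refine ⟨fun i _ j _ hij => atom_mutuallyDisjoint hp hij, fun n hn => ?_, fun n hn => ?_⟩ <;>
    obtain ⟨k, hk, hsub⟩ := hY.subset n hn
  · exact hsub.trans (h.subset k hk)
  · exact (h.simple k hk).restrict hsub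

theorem SimpleFamily.union_atom (h : SimpleFamily A f (atom p hp) Y)
    (h' : SimpleFamily A f (atom p hp) Y') : SimpleFamily A f (atom p hp) (Y ∪ Y') :=
  ⟨fun _ _ _ _ hij => atom_mutuallyDisjoint hp hij,
    fun n hn => (Finset.mem_union.1 hn).elim (h.subset n) (h'.subset n),
    fun n hn => (Finset.mem_union.1 hn).elim (h.simple n) (h'.simple n)⟩

end Subdivision

/-- The empty interval, with which finite families are padded. -/
noncomputable def emptyInterval : Interval where
  left := 0
  right := 0
  left_le_right := le_rfl
  carrier := ∅
  Ioo_subset := by rw [Set.Ioo_self]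
  subset_Icc := Set.empty_subset _

/-- A finite family of intervals as a sequence, in which the definitions of measure and integral
are phrased. -/
noncomputable def pad (L : ℕ → Interval) (X : Finset ℕ) (n : ℕ) : Interval :=
  if n ∈ X then L n else emptyInterval

section Pad

variable {A : Set LeviCivita} {f : LeviCivita → LeviCivita} {L : ℕ → Interval} {X : Finset ℕ}

theorem pad_mutuallyDisjoint (hd : (X : Set ℕ).PairwiseDisjoint fun k => (L k).carrier) :
    MutuallyDisjoint (pad L X) := by
  intro i j hij
  simp only [pad]
  split_ifs with hi hj hj
  · exact hd hi hj hij
  · exact Set.disjoint_empty _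
  · exact Set.empty_disjoint _
  · exact Set.empty_disjoint _

theorem seriesTo_pad (L : ℕ → Interval) (X : Finset ℕ) {Ψ : Interval → LeviCivita}
    (h : Ψ emptyInterval = 0) : SeriesTo (fun n => Ψ (pad L X n)) (∑ k ∈ X, Ψ (L k)) := by
  obtain ⟨N, hN⟩ := X.exists_nat_subset_range
  refine tendsto_const_nhds.congr' ?_
  filter_upwards [eventually_ge_atTop N] with M hM
  rw [← Finset.sum_subset (hN.trans (Finset.range_subset_range.2 hM))]
  · exact Finset.sum_congr rfl fun k hk => by rw [pad, if_pos hk]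
  · intro k _ hk
    rw [pad, if_neg hk, h]

theorem seriesTo_pad_length (L : ℕ → Interval) (X : Finset ℕ) :
    SeriesTo (fun n => (pad L X n).length) (totalLength L X) :=
  seriesTo_pad L X (Ψ := Interval.length) (sub_self 0)

theorem SimpleFamily.pad_mem (h : SimpleFamily A f L X) : pad L X ∈ simpleFamilies A f := by
  refine ⟨pad_mutuallyDisjoint h.disjoint, Set.iUnion_subset fun n => ?_, fun n => ?_⟩ <;>
    rw [pad] <;> split_ifs with hn
  · exact h.subset n hn
  · exact Set.empty_subset _
  · exact h.simple n hn
  · exact isSimpleOn_of_left_eq_right f rfl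

theorem SimpleFamily.totalLength_le (h : SimpleFamily A f L X) {μ : LeviCivita}
    (hμ : IsMeasureOf A μ) : totalLength L X ≤ μ :=
  hμ.1.1 ⟨pad L X, h.pad_mem.1, h.pad_mem.2.1, seriesTo_pad_length L X⟩

end Pad

/-! ### Integration over measurable sets -/

/-- The integrals of `f` over finite families of small total length are small. This absolute
continuity, which passes to dominated functions, makes the integral of `f` exist. -/
def HasAbsContIntegral (A : Set LeviCivita) (f : LeviCivita → LeviCivita) : Prop :=
  ∀ ε : LeviCivita, 0 < ε → ∃ δ : LeviCivita, 0 < δ ∧ ∀ L X, SimpleFamily A f L X →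
    totalLength L X < δ → |totalIntegral f L X| < ε

section Integration

variable {A : Set LeviCivita} {μ : LeviCivita} {f g h φ : LeviCivita → LeviCivita}
  {L : ℕ → Interval} {X : Finset ℕ}

theorem IsMeasureOf.unique {μ' : LeviCivita} (hμ : IsMeasureOf A μ) (hμ' : IsMeasureOf A μ') :
    μ = μ' := hμ.1.unique hμ'.1

theorem SimpleFamily.of_mem_simpleFamilies {I : ℕ → Interval} (hI : I ∈ simpleFamilies A f)
    (X : Finset ℕ) : SimpleFamily A f I X :=
  ⟨fun _ _ _ _ hij => hI.1 hij, fun k _ => (Set.subset_iUnion _ k).trans hI.2.1,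
    fun k _ => hI.2.2 k⟩

theorem MeasurableFun.exists_simpleFamily (hf : MeasurableFun A f) (hμ : IsMeasureOf A μ)
    {ε : LeviCivita} (hε : 0 < ε) : ∃ L X, SimpleFamily A f L X ∧ μ - totalLength L X < ε := by
  obtain ⟨-, μ', hμ', h⟩ := hf
  rw [hμ'.unique hμ] at h
  obtain ⟨I, s, hd, hsub, hs, hlt, hsimple⟩ := h ε hε
  obtain ⟨N, hN⟩ := ((tendsto_const_nhds.sub hs).eventually_lt_const hlt).exists
  exact ⟨I, Finset.range N, .of_mem_simpleFamilies ⟨hd, hsub, hsimple⟩ _, hN⟩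

theorem HasIntegral.exists_delta {w : LeviCivita} (hφ : HasIntegral A φ w) (hμ : IsMeasureOf A μ)
    {ε : LeviCivita} (hε : 0 < ε) : ∃ δ : LeviCivita, 0 < δ ∧ ∀ L X, SimpleFamily A φ L X →
      μ - totalLength L X < δ → |totalIntegral φ L X - w| < ε := by
  obtain ⟨-, μ', hμ', h⟩ := hφ
  rw [hμ'.unique hμ] at h
  obtain ⟨δ, hδ, h⟩ := h ε hε
  refine ⟨δ, hδ, fun L X hL hlt => ?_⟩
  obtain ⟨σ, t, hσ, ht, htw⟩ := h (pad L X) hL.pad_mem _ (seriesTo_pad_length L X)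
    (by rwa [abs_of_nonneg (sub_nonneg.2 (hL.totalLength_le hμ))])
  rw [show σ = fun n => simpleIntegral φ (pad L X n) from funext fun n => (hσ n).eq] at ht
  rwa [tendsto_nhds_unique ht
    (seriesTo_pad L X (Ψ := simpleIntegral φ) (simpleIntegral_of_left_eq_right rfl))] at htw

theorem SimpleFamily.totalLength_sdiff_le {p : ℕ → LeviCivita} {hp : Monotone p} {Y Y' : Finset ℕ}
    (hf : SimpleFamily A f (atom p hp) Y) (hg : SimpleFamily A g (atom p hp) Y')
    (hμ : IsMeasureOf A μ) :
    totalLength (atom p hp) (Y \ Y') ≤ μ - totalLength (atom p hp) Y' := by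
  have hle : totalLength (atom p hp) (Y \ Y' ∪ Y') ≤ μ :=
    (((hf.const 1).mono Finset.sdiff_subset).union_atom (hg.const 1)).totalLength_le hμ
  rw [totalLength, Finset.sum_union Finset.sdiff_disjoint] at hle
  exact le_sub_iff_add_le.2 hle

theorem HasIntegral.hasAbsContIntegral {w : LeviCivita} (hφ : HasIntegral A φ w) :
    HasAbsContIntegral A φ := by
  obtain ⟨hm, μ, hμ, -⟩ := id hφ
  intro ε hε
  obtain ⟨δ, hδ, h⟩ := hφ.exists_delta hμ (half_pos hε)
  obtain ⟨K, Z, hK, hKlt⟩ := hm.exists_simpleFamily hμ (half_pos hδ)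
  refine ⟨δ / 2, half_pos hδ, fun L X hL hlt => ?_⟩
  obtain ⟨p, hp, Y, Y', hY, hY'⟩ := exists_common_refinement hL.disjoint hK.disjoint
  -- Both `Y ∪ Y'` and `Y' \ Y` nearly exhaust `A`, and their integrals differ by that over `Y`.
  have hunion := (hL.of_refines hY).union_atom (hK.of_refines hY')
  have hsdiff := (hK.of_refines hY').mono (Finset.sdiff_subset (s := Y') (t := Y))
  have hsum : ∀ u : ℕ → LeviCivita, ∑ n ∈ Y ∪ Y', u n = ∑ n ∈ Y, u n + ∑ n ∈ Y' \ Y, u n :=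
    fun u => by rw [← Finset.union_sdiff_self_eq_union, Finset.sum_union Finset.disjoint_sdiff]
  have hlength : totalLength (atom p hp) (Y ∪ Y') =
      totalLength (atom p hp) Y + totalLength (atom p hp) (Y' \ Y) := hsum _
  have hintegral : totalIntegral φ (atom p hp) (Y ∪ Y') =
      totalIntegral φ (atom p hp) Y + totalIntegral φ (atom p hp) (Y' \ Y) := hsum _
  have hmono := totalLength_mono (atom p hp) (Finset.subset_union_right (s₁ := Y) (s₂ := Y'))
  rw [hY.totalLength_eq] at hlt
  rw [hY'.totalLength_eq] at hKlt
  have hunion_lt := abs_lt.1 (h _ _ hunion (by linarith))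
  have hsdiff_lt := abs_lt.1 (h _ _ hsdiff (by linarith))
  rw [hY.totalIntegral_eq φ hL.simple, abs_lt]
  constructor <;> linarith [hunion_lt.1, hunion_lt.2, hsdiff_lt.1, hsdiff_lt.2]

theorem SimpleFamily.exists_bound (hL : SimpleFamily A f L X) :
    ∃ B, 0 < B ∧ ∀ k ∈ X, ∀ x ∈ (L k).carrier, |f x| ≤ B := by
  choose! B hB h using fun k hk => (hL.simple k hk).exists_bound
  refine ⟨1 + ∑ k ∈ X, B k, add_pos_of_pos_of_nonneg one_pos
    (Finset.sum_nonneg fun k hk => (hB k hk).le), fun k hk x hx => (h k hk x hx).trans ?_⟩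
  exact (Finset.single_le_sum (fun k hk => (hB k hk).le) hk).trans
    (le_add_of_nonneg_left zero_le_one)

theorem abs_totalIntegral_le (hf : ∀ k ∈ X, IsSimpleOn f (L k))
    (hg : ∀ k ∈ X, IsSimpleOn g (L k)) (h : ∀ k ∈ X, ∀ x ∈ (L k).carrier, |f x| ≤ g x) :
    |totalIntegral f L X| ≤ totalIntegral g L X :=
  (Finset.abs_sum_le_sum_abs _ _).trans (Finset.sum_le_sum fun k hk =>
    abs_simpleIntegral_le (hf k hk) (hg k hk) (h k hk))

theorem HasAbsContIntegral.of_abs_le (hφ : HasAbsContIntegral A φ) (hm : MeasurableFun A φ)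
    (hle : ∀ x ∈ A, |f x| ≤ φ x) : HasAbsContIntegral A f := by
  obtain ⟨-, μ, hμ, -⟩ := id hm
  intro ε hε
  obtain ⟨δ, hδ, h⟩ := hφ (ε / 2) (half_pos hε)
  refine ⟨δ, hδ, fun L X hL hlt => ?_⟩
  obtain ⟨B, hB, hbound⟩ := hL.exists_bound
  -- `φ` need not be simple on the `L k`; outside a family where it is, the bound `B` suffices.
  obtain ⟨K, Z, hK, hKlt⟩ := hm.exists_simpleFamily hμ (ε := ε / 2 / B) (by positivity)
  obtain ⟨p, hp, Y, Y', hY, hY'⟩ := exists_common_refinement hL.disjoint hK.disjoint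
  have hYf := hL.of_refines hY
  have hYφ := hK.of_refines hY'
  rw [hY.totalLength_eq] at hlt
  rw [hY'.totalLength_eq, lt_div_iff₀' hB] at hKlt
  have hinter : |totalIntegral f (atom p hp) (Y ∩ Y')| < ε / 2 :=
    calc |totalIntegral f (atom p hp) (Y ∩ Y')|
        ≤ totalIntegral φ (atom p hp) (Y ∩ Y') :=
          abs_totalIntegral_le (hYf.mono Finset.inter_subset_left).simple
            (hYφ.mono Finset.inter_subset_right).simple fun n hn x hx =>
              hle x (hYf.subset n (Finset.inter_subset_left hn) hx)
      _ < ε / 2 := lt_of_abs_lt (h _ _ (hYφ.mono Finset.inter_subset_right)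
          ((totalLength_mono _ Finset.inter_subset_left).trans_lt hlt))
  have hsdiff : |totalIntegral f (atom p hp) (Y \ Y')| < ε / 2 :=
    calc |totalIntegral f (atom p hp) (Y \ Y')|
        ≤ totalIntegral (fun _ => B) (atom p hp) (Y \ Y') :=
          abs_totalIntegral_le (hYf.mono Finset.sdiff_subset).simple
            (fun _ _ => isSimpleOn_const B _) fun n hn x hx => by
              obtain ⟨k, hk, hsub⟩ := hY.subset n (Finset.sdiff_subset hn)
              exact hbound k hk x (hsub hx)
      _ = B * totalLength (atom p hp) (Y \ Y') := totalIntegral_const B _ _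
      _ ≤ B * (μ - totalLength (atom p hp) Y') :=
          mul_le_mul_of_nonneg_left (hYf.totalLength_sdiff_le hYφ hμ) hB.le
      _ < ε / 2 := hKlt
  rw [hY.totalIntegral_eq f hL.simple, totalIntegral, ← Finset.sum_inter_add_sum_sdiff Y Y']
  exact (abs_add_le _ _).trans_lt ((add_lt_add hinter hsdiff).trans_eq (add_halves ε))

theorem HasAbsContIntegral.cauchy (hf : HasAbsContIntegral A f) (hμ : IsMeasureOf A μ)
    {ε : LeviCivita} (hε : 0 < ε) :
    ∃ δ : LeviCivita, 0 < δ ∧ ∀ L X L' X', SimpleFamily A f L X → SimpleFamily A f L' X' →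
      μ - totalLength L X < δ → μ - totalLength L' X' < δ →
      |totalIntegral f L X - totalIntegral f L' X'| < ε := by
  obtain ⟨δ, hδ, h⟩ := hf (ε / 2) (half_pos hε)
  refine ⟨δ, hδ, fun L X L' X' hL hL' hlt hlt' => ?_⟩
  obtain ⟨p, hp, Y, Y', hY, hY'⟩ := exists_common_refinement hL.disjoint hL'.disjoint
  have hYf := hL.of_refines hY
  have hYf' := hL'.of_refines hY'
  rw [hY.totalLength_eq] at hlt
  rw [hY'.totalLength_eq] at hlt'
  rw [hY.totalIntegral_eq f hL.simple, hY'.totalIntegral_eq f hL'.simple]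
  calc |totalIntegral f (atom p hp) Y - totalIntegral f (atom p hp) Y'|
      = |totalIntegral f (atom p hp) (Y \ Y') - totalIntegral f (atom p hp) (Y' \ Y)| := by
        simp only [totalIntegral, Finset.sum_sdiff_sub_sum_sdiff]
    _ ≤ |totalIntegral f (atom p hp) (Y \ Y')| + |totalIntegral f (atom p hp) (Y' \ Y)| :=
        abs_sub _ _
    _ < ε / 2 + ε / 2 := add_lt_add
        (h _ _ (hYf.mono Finset.sdiff_subset) ((hYf.totalLength_sdiff_le hYf' hμ).trans_lt hlt'))
        (h _ _ (hYf'.mono Finset.sdiff_subset) ((hYf'.totalLength_sdiff_le hYf hμ).trans_lt hlt))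
    _ = ε := add_halves ε

theorem HasAbsContIntegral.exists_limit (hf : HasAbsContIntegral A f) (hm : MeasurableFun A f)
    (hμ : IsMeasureOf A μ) : ∃ v, ∀ ε : LeviCivita, 0 < ε → ∃ δ : LeviCivita, 0 < δ ∧
      ∀ L X, SimpleFamily A f L X → μ - totalLength L X < δ → |totalIntegral f L X - v| < ε := by
  choose L X hL hlt using fun n : ℕ => hm.exists_simpleFamily hμ (monomial_pos n one_pos)
  have hsmall : ∀ {δ : LeviCivita}, 0 < δ → ∀ᶠ n : ℕ in atTop, monomial n 1 < δ := fun hδ =>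
    tendsto_monomial_natCast_atTop.eventually_lt_const hδ
  obtain ⟨v, hv⟩ : ∃ v, Tendsto (fun n => totalIntegral f (L n) (X n)) atTop (𝓝 v) := by
    refine exists_tendsto_of_suppGE_sub fun m => ?_
    obtain ⟨δ, hδ, h⟩ := hf.cauchy hμ (monomial_pos m one_pos)
    obtain ⟨N, hN⟩ := eventually_atTop.1 (hsmall hδ)
    exact ⟨N, fun n hn => SuppGE.of_abs_le (h _ _ _ _ (hL n) (hL N) ((hlt n).trans (hN n hn))
      ((hlt N).trans (hN N le_rfl))).le (suppGE_monomial m 1)⟩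
  refine ⟨v, fun ε hε => ?_⟩
  obtain ⟨δ, hδ, h⟩ := hf.cauchy hμ (half_pos hε)
  refine ⟨δ, hδ, fun K Z hK hKlt => ?_⟩
  obtain ⟨n, hn, hnv⟩ := ((hsmall hδ).and
    (LinearOrderedAddCommGroup.tendsto_nhds.1 hv _ (half_pos hε))).exists
  exact (abs_sub_le _ _ _).trans_lt ((add_lt_add
    (h _ _ _ _ hK (hL n) hKlt ((hlt n).trans hn)) hnv).trans_eq (add_halves ε))

theorem HasAbsContIntegral.tendsto_simpleIntegral (hf : HasAbsContIntegral A f) {I : ℕ → Interval}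
    (hI : I ∈ simpleFamilies A f) {s : LeviCivita} (hs : SeriesTo (fun n => (I n).length) s) :
    Tendsto (fun n => simpleIntegral f (I n)) atTop (𝓝 0) := by
  rw [LinearOrderedAddCommGroup.tendsto_nhds]
  intro ε hε
  obtain ⟨δ, hδ, h⟩ := hf ε hε
  filter_upwards [hs.tendsto_zero.eventually_lt_const hδ] with n hn
  simpa [totalIntegral] using
    h I {n} (.of_mem_simpleFamilies hI _) (by simpa [totalLength] using hn)

theorem HasAbsContIntegral.exists_hasIntegral (hf : HasAbsContIntegral A f)
    (hm : MeasurableFun A f) : ∃ v, HasIntegral A f v := by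
  obtain ⟨-, μ, hμ, -⟩ := id hm
  obtain ⟨v, hv⟩ := hf.exists_limit hm hμ
  refine ⟨v, hm, μ, hμ, fun ε hε => ?_⟩
  obtain ⟨δ, hδ, h⟩ := hv (ε / 2) (half_pos hε)
  refine ⟨δ, hδ, fun I hI s hs hμs => ?_⟩
  obtain ⟨t, ht⟩ := exists_seriesTo (hf.tendsto_simpleIntegral hI hs)
  refine ⟨_, t, fun n => (hI.2.2 n).hasSimpleIntegral, ht, ?_⟩
  obtain ⟨N, hNs, hNt⟩ := (((tendsto_const_nhds.sub hs).eventually_lt_const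
    (lt_of_abs_lt hμs)).and
      (LinearOrderedAddCommGroup.tendsto_nhds.1 ht _ (half_pos hε))).exists
  rw [abs_sub_comm] at hNt
  exact (abs_sub_le _ _ _).trans_lt ((add_lt_add hNt
    (h I _ (.of_mem_simpleFamilies hI (Finset.range N)) hNs)).trans_eq (add_halves ε))

theorem HasIntegral.exists_of_abs_le {w : LeviCivita} (hφ : HasIntegral A φ w)
    (hf : MeasurableFun A f) (hle : ∀ x ∈ A, |f x| ≤ φ x) : ∃ v, HasIntegral A f v :=
  (hφ.hasAbsContIntegral.of_abs_le hφ.1 hle).exists_hasIntegral hf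

theorem MeasurableFun.exists_common_simpleFamily (hf : MeasurableFun A f)
    (hg : MeasurableFun A g) (hμ : IsMeasureOf A μ) {ε : LeviCivita} (hε : 0 < ε) :
    ∃ L X, SimpleFamily A f L X ∧ SimpleFamily A g L X ∧ μ - totalLength L X < ε := by
  obtain ⟨L, X, hL, hlt⟩ := hf.exists_simpleFamily hμ (half_pos hε)
  obtain ⟨L', X', hL', hlt'⟩ := hg.exists_simpleFamily hμ (half_pos hε)
  obtain ⟨p, hp, Y, Y', hY, hY'⟩ := exists_common_refinement hL.disjoint hL'.disjoint
  have hYf := hL.of_refines hY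
  have hYg := hL'.of_refines hY'
  rw [hY.totalLength_eq] at hlt
  rw [hY'.totalLength_eq] at hlt'
  have hsdiff := hYf.totalLength_sdiff_le hYg hμ
  have hsplit : totalLength (atom p hp) Y = totalLength (atom p hp) (Y ∩ Y') +
      totalLength (atom p hp) (Y \ Y') := (Finset.sum_inter_add_sum_sdiff Y Y' _).symm
  exact ⟨atom p hp, Y ∩ Y', hYf.mono Finset.inter_subset_left, hYg.mono Finset.inter_subset_right,
    by linarith⟩

theorem MeasurableFun.of_isSimpleOn (hf : MeasurableFun A f) (hg : MeasurableFun A g)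
    (hs : ∀ I : Interval, I.carrier ⊆ A → IsSimpleOn f I → IsSimpleOn g I → IsSimpleOn h I) :
    MeasurableFun A h := by
  obtain ⟨hA, μ, hμ, -⟩ := id hf
  refine ⟨hA, μ, hμ, fun ε hε => ?_⟩
  obtain ⟨L, X, hLf, hLg, hlt⟩ := hf.exists_common_simpleFamily hg hμ hε
  have hL : SimpleFamily A h L X := ⟨hLf.disjoint, hLf.subset, fun k hk =>
    hs (L k) (hLf.subset k hk) (hLf.simple k hk) (hLg.simple k hk)⟩
  obtain ⟨hdisj, hsub, hsimple⟩ := hL.pad_mem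
  exact ⟨pad L X, _, hdisj, hsub, seriesTo_pad_length L X, hlt, hsimple⟩

theorem HasIntegral.mono {u v : LeviCivita} (hf : HasIntegral A f u) (hg : HasIntegral A g v)
    (h : ∀ x ∈ A, f x ≤ g x) : u ≤ v := by
  obtain ⟨hfm, μ, hμ, -⟩ := id hf
  refine le_of_forall_pos_lt_add fun ε hε => ?_
  obtain ⟨δ, hδ, hd⟩ := hf.exists_delta hμ (half_pos hε)
  obtain ⟨δ', hδ', hd'⟩ := hg.exists_delta hμ (half_pos hε)
  obtain ⟨L, X, hLf, hLg, hlt⟩ := hfm.exists_common_simpleFamily hg.1 hμ (lt_min hδ hδ')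
  have hfu := abs_lt.1 (hd L X hLf (hlt.trans_le (min_le_left _ _)))
  have hgv := abs_lt.1 (hd' L X hLg (hlt.trans_le (min_le_right _ _)))
  have hle : totalIntegral f L X ≤ totalIntegral g L X := Finset.sum_le_sum fun k hk =>
    simpleIntegral_mono (hLf.simple k hk) (hLg.simple k hk) fun x hx => h x (hLf.subset k hk hx)
  linarith [hfu.1, hgv.2]

theorem SimpleFamily.totalIntegral_sub (hf : SimpleFamily A f L X) (hg : SimpleFamily A g L X) :
    totalIntegral (fun x => f x - g x) L X = totalIntegral f L X - totalIntegral g L X := by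
  rw [totalIntegral, totalIntegral, totalIntegral, ← Finset.sum_sub_distrib]
  exact Finset.sum_congr rfl fun k hk => simpleIntegral_sub (hf.simple k hk) (hg.simple k hk)

theorem HasIntegral.sub_eq {u v w : LeviCivita} (hf : HasIntegral A f u) (hg : HasIntegral A g v)
    (hfg : HasIntegral A (fun x => f x - g x) w) : u - v = w := by
  obtain ⟨hfm, μ, hμ, -⟩ := id hf
  refine eq_of_abs_sub_lt_all fun ε hε => ?_
  have hε3 : 0 < ε / 3 := by positivity
  obtain ⟨δ, hδ, hd⟩ := hf.exists_delta hμ hε3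
  obtain ⟨δ', hδ', hd'⟩ := hg.exists_delta hμ hε3
  obtain ⟨δ'', hδ'', hd''⟩ := hfg.exists_delta hμ hε3
  obtain ⟨L, X, hLf, hLg, hlt⟩ :=
    hfm.exists_common_simpleFamily hg.1 hμ (lt_min hδ (lt_min hδ' hδ''))
  rw [lt_min_iff, lt_min_iff] at hlt
  have hLfg : SimpleFamily A (fun x => f x - g x) L X :=
    ⟨hLf.disjoint, hLf.subset, fun k hk => (hLf.simple k hk).sub (hLg.simple k hk)⟩
  have hu := abs_lt.1 (hd L X hLf hlt.1)
  have hv := abs_lt.1 (hd' L X hLg hlt.2.1)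
  have hw := abs_lt.1 (hd'' L X hLfg hlt.2.2)
  rw [hLf.totalIntegral_sub hLg] at hw
  exact abs_lt.2 ⟨by linarith [hu.2, hv.1, hw.1], by linarith [hu.1, hv.2, hw.2]⟩

end Integration

/-! ### Standard parts -/

theorem st_mono {x y : LeviCivita} (h : x ≤ y) : st x ≤ st y :=
  sInf_le_sInf fun _ ⟨r, hr, hs⟩ => ⟨r, h.trans hr, hs⟩

theorem isFinite_zero : IsFinite 0 :=
  ⟨1, by rw [abs_zero, ofReal_one]; exact one_pos⟩

theorem IsFinite.of_abs_le {x y : LeviCivita} (hy : IsFinite y) (h : |x| ≤ |y|) : IsFinite x := by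
  obtain ⟨r, hr⟩ := hy
  exact ⟨r, h.trans_lt hr⟩

theorem IsFinite.sub {x y : LeviCivita} (hx : IsFinite x) (hy : IsFinite y) : IsFinite (x - y) := by
  obtain ⟨r, hr⟩ := hx
  obtain ⟨s, hs⟩ := hy
  refine ⟨r + s, (abs_sub x y).trans_lt ?_⟩
  rw [ofReal_add]
  exact add_lt_add hr hs

theorem IsFinite.st_eq {x : LeviCivita} (hx : IsFinite x) : st x = (coeff x 0 : EReal) := by
  obtain ⟨R, hR⟩ := hx
  have hsupp : SuppGE 0 x := suppGE_of_abs_le_ofReal hR.le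
  refine le_antisymm (le_of_forall_gt_imp_ge_of_dense fun a ha => ?_) (le_sInf ?_)
  · obtain ⟨r, hr, hra⟩ := EReal.lt_iff_exists_real_btwn.1 ha
    have hxr : x < ofReal r := by
      refine lt_iff_coeff.2 ⟨0, fun q hq => ?_, ?_⟩
      · rw [hsupp q hq, suppGE_ofReal r q hq]
      · rw [coeff_ofReal, if_pos rfl]
        exact EReal.coe_lt_coe_iff.1 hr
    have hmem : (r : EReal) ∈ {s : EReal | ∃ r : ℝ, x ≤ ofReal r ∧ s = r} := ⟨r, hxr.le, rfl⟩
    exact (sInf_le hmem).trans hra.le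
  · rintro _ ⟨r, hr, rfl⟩
    have hcoeff := coeff_nonneg_of_nonneg (sub_nonneg.2 hr) ((suppGE_ofReal r).sub hsupp)
    rw [coeff_sub, coeff_ofReal, if_pos rfl] at hcoeff
    exact EReal.coe_le_coe_iff.2 (sub_nonneg.1 hcoeff)

theorem IsFinite.st_sub {x y : LeviCivita} (hx : IsFinite x) (hy : IsFinite y) :
    st (x - y) = st x - st y := by
  rw [(hx.sub hy).st_eq, hx.st_eq, hy.st_eq, coeff_sub, EReal.coe_sub]

theorem st_zero : st 0 = 0 := by
  rw [isFinite_zero.st_eq, coeff_zero, EReal.coe_zero]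

/-! ### The `M`-integral of integrable functions -/

section MIntegral

variable {A : Set LeviCivita} {f φ : LeviCivita → LeviCivita} {v p n w : LeviCivita}

theorem pos_nonneg (f : LeviCivita → LeviCivita) (x : LeviCivita) : 0 ≤ pos f x := le_max_right _ _

theorem neg_nonneg (f : LeviCivita → LeviCivita) (x : LeviCivita) : 0 ≤ neg f x := le_max_right _ _

theorem pos_le_abs (f : LeviCivita → LeviCivita) (x : LeviCivita) : pos f x ≤ |f x| :=
  max_le (le_abs_self _) (abs_nonneg _)

theorem neg_le_abs (f : LeviCivita → LeviCivita) (x : LeviCivita) : neg f x ≤ |f x| :=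
  max_le (_root_.neg_le_abs _) (abs_nonneg _)

theorem pos_sub_neg (f : LeviCivita → LeviCivita) : (fun x => pos f x - neg f x) = f :=
  funext fun x => max_zero_sub_max_neg_zero_eq_self (f x)

theorem half_mul_abs_add_self (f : LeviCivita → LeviCivita) (x : LeviCivita) :
    ofReal (1 / 2) * (|f x| + f x) = pos f x := by
  have hhalf : ofReal (1 / 2) + ofReal (1 / 2) = 1 := by
    rw [← ofReal_add, add_halves, ofReal_one]
  rw [pos]
  rcases abs_cases (f x) with ⟨habs, hsign⟩ | ⟨habs, hsign⟩
  · rw [habs, max_eq_left hsign]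
    linear_combination f x * hhalf
  · rw [habs, max_eq_right hsign.le, neg_add_cancel, mul_zero]

theorem IsSimpleOn.pos {I : Interval} (hf : IsSimpleOn f I)
    (habs : IsSimpleOn (fun x => |f x|) I) : IsSimpleOn (pos f) I :=
  ((habs.add hf).ofReal_mul (r := 1 / 2) (by norm_num [abs_of_pos])).congr fun x _ =>
    half_mul_abs_add_self f x

theorem MeasurableFun.pos (hf : MeasurableFun A f) (habs : MeasurableFun A fun x => |f x|) :
    MeasurableFun A (pos f) :=
  hf.of_isSimpleOn habs fun _ _ hs hs' => hs.pos hs'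

theorem MeasurableFun.neg (hf : MeasurableFun A f) (habs : MeasurableFun A fun x => |f x|) :
    MeasurableFun A (neg f) :=
  hf.of_isSimpleOn habs fun _ _ hs hs' => hs.neg.pos (by simpa only [abs_neg] using hs')

theorem MeasurableFun.hasIntegral_zero (hf : MeasurableFun A f) :
    HasIntegral A (fun _ => 0) 0 := by
  have habs : HasAbsContIntegral A fun _ => 0 := fun ε hε => ⟨1, one_pos, fun L X _ _ => by
    rwa [totalIntegral_const, zero_mul, abs_zero]⟩
  obtain ⟨z, hz⟩ := habs.exists_hasIntegral
    (hf.of_isSimpleOn hf fun I _ _ _ => isSimpleOn_const 0 I)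
  have hz0 : z - z = z := hz.sub_eq hz (by simpa only [sub_zero] using hz)
  rwa [← hz0, sub_self] at hz

theorem HasIntegral.nonneg (hv : HasIntegral A f v) (h : ∀ x ∈ A, 0 ≤ f x) : 0 ≤ v :=
  hv.1.hasIntegral_zero.mono hv h

theorem HasIntegral.isFinite_of_le (hv : HasIntegral A f v) (h0 : ∀ x ∈ A, 0 ≤ f x)
    (hw : HasIntegral A φ w) (hwfin : IsFinite w) (hle : ∀ x ∈ A, f x ≤ φ x) : IsFinite v := by
  refine hwfin.of_abs_le ?_
  rw [abs_of_nonneg (hv.nonneg h0)]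
  exact (hv.mono hw hle).trans (le_abs_self w)

theorem HasIntegral.memL1_of_nonneg (hv : HasIntegral A f v) (h : ∀ x, 0 ≤ f x) : MemL1 A f :=
  ⟨hv.1, v, by simpa only [abs_of_nonneg (h _)] using hv⟩

theorem HasIntegral.exists_pos (hw : HasIntegral A (fun x => |f x|) w) (hf : MeasurableFun A f)
    (hwfin : IsFinite w) : ∃ p, HasIntegral A (LC.pos f) p ∧ IsFinite p := by
  obtain ⟨p, hp⟩ := hw.exists_of_abs_le (hf.pos hw.1) fun x _ =>
    (abs_of_nonneg (pos_nonneg f x)).le.trans (pos_le_abs f x)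
  exact ⟨p, hp, hp.isFinite_of_le (fun x _ => pos_nonneg f x) hw hwfin fun x _ => pos_le_abs f x⟩

theorem HasIntegral.exists_neg (hw : HasIntegral A (fun x => |f x|) w) (hf : MeasurableFun A f)
    (hwfin : IsFinite w) : ∃ n, HasIntegral A (LC.neg f) n ∧ IsFinite n := by
  obtain ⟨n, hn⟩ := hw.exists_of_abs_le (hf.neg hw.1) fun x _ =>
    (abs_of_nonneg (neg_nonneg f x)).le.trans (neg_le_abs f x)
  exact ⟨n, hn, hn.isFinite_of_le (fun x _ => neg_nonneg f x) hw hwfin fun x _ => neg_le_abs f x⟩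

theorem HasIntegral.pos_sub_neg (hv : HasIntegral A f v) (hp : HasIntegral A (pos f) p)
    (hn : HasIntegral A (neg f) n) : p - n = v :=
  hp.sub_eq hn (by rwa [LC.pos_sub_neg])

theorem HasIntegral.lowerMIntegral_eq (hv : HasIntegral A f v) (hf : MemL1 A f) :
    lowerMIntegral A f = st v := by
  refine le_antisymm (sSup_le ?_) (le_sSup ⟨f, v, hf, fun _ _ => le_rfl, hv, rfl⟩)
  rintro _ ⟨g, u, -, hgf, hu, rfl⟩
  exact st_mono (hu.mono hv hgf)

theorem HasIntegral.upperMIntegral_eq (hv : HasIntegral A f v) (hf : MemL1 A f) :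
    upperMIntegral A f = st v := by
  refine le_antisymm (sInf_le ⟨f, v, hf, fun _ _ => le_rfl, hv, rfl⟩) (le_sInf ?_)
  rintro _ ⟨g, u, -, hgf, hu, rfl⟩
  exact st_mono (hv.mono hu hgf)

theorem HasIntegral.basicMIntegrable (hv : HasIntegral A f v) (hf : MemL1 A f) (hvfin : IsFinite v)
    (h : BoundedOn A f ∨ ∀ x ∈ A, 0 ≤ f x) : BasicMIntegrable A f := by
  by_cases hb : BoundedOn A f
  · exact Or.inl ⟨hb, (hv.lowerMIntegral_eq hf).trans (hv.upperMIntegral_eq hf).symm⟩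
  · refine Or.inr ⟨hb, h.resolve_left hb, ?_⟩
    rw [hv.lowerMIntegral_eq hf, hvfin.st_eq]
    exact EReal.coe_lt_top _

theorem HasIntegral.mIntegrable (hv : HasIntegral A f v) (hf : MemL1 A f)
    (hp : HasIntegral A (pos f) p) (hpfin : IsFinite p)
    (hn : HasIntegral A (neg f) n) (hnfin : IsFinite n) : MIntegrable A f := by
  have hpos : BasicMIntegrable A (pos f) := hp.basicMIntegrable
    (hp.memL1_of_nonneg (pos_nonneg f)) hpfin (Or.inr fun x _ => pos_nonneg f x)
  have hneg : BasicMIntegrable A (neg f) := hn.basicMIntegrable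
    (hn.memL1_of_nonneg (neg_nonneg f)) hnfin (Or.inr fun x _ => neg_nonneg f x)
  have hvfin : IsFinite v := hv.pos_sub_neg hp hn ▸ hpfin.sub hnfin
  rw [MIntegrable]
  split_ifs with hbasic hnonpos
  · exact hv.basicMIntegrable hf hvfin hbasic
  · exact hneg
  · exact ⟨hpos, hneg⟩

theorem HasIntegral.mIntegral_eq_st (hv : HasIntegral A f v) (hf : MemL1 A f)
    (hp : HasIntegral A (pos f) p) (hpfin : IsFinite p)
    (hn : HasIntegral A (neg f) n) (hnfin : IsFinite n) : mIntegral A f = st v := by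
  have hst : st v = st p - st n := by rw [← hv.pos_sub_neg hp hn, hpfin.st_sub hnfin]
  have hneg : lowerMIntegral A (neg f) = st n :=
    hn.lowerMIntegral_eq (hn.memL1_of_nonneg (neg_nonneg f))
  rw [mIntegral]
  split_ifs with hbasic hnonpos
  · exact hv.lowerMIntegral_eq hf
  · have hp0 : p = 0 := le_antisymm
      (hp.mono hp.1.hasIntegral_zero fun x hx => max_le (hnonpos x hx) le_rfl)
      (hp.nonneg fun x _ => pos_nonneg f x)
    rw [hneg, hst, hp0, st_zero, zero_sub]
  · rw [hp.lowerMIntegral_eq (hp.memL1_of_nonneg (pos_nonneg f)), hneg, hst]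

end MIntegral

end LC

theorem mainTheorem9 (A : Set LC.LeviCivita) (hA : LC.MeasurableSubset A)
    (f : LC.LeviCivita → LC.LeviCivita) (hf : LC.MemL1 A f)
    (hfin : ∃ w, LC.HasIntegral A (fun x => |f x|) w ∧ LC.IsFinite w) :
    LC.MIntegrable A f ∧ (∃ v, LC.HasIntegral A f v) ∧
      ∀ v, LC.HasIntegral A f v → LC.mIntegral A f = LC.st v := by
  obtain ⟨w, hw, hwfin⟩ := hfin
  obtain ⟨v, hv⟩ := hw.exists_of_abs_le hf.1 fun _ _ => le_rfl
  obtain ⟨p, hp, hpfin⟩ := hw.exists_pos hf.1 hwfin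
  obtain ⟨n, hn, hnfin⟩ := hw.exists_neg hf.1 hwfin
  exact ⟨hv.mIntegrable hf hp hpfin hn hnfin, ⟨v, hv⟩,
    fun u hu => hu.mIntegral_eq_st hf hp hpfin hn hnfin⟩
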